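/- **Setting.** Let $T>0$, $x_0\in\mathbb R^n$, $a_0\in\mathbb R^{mn}$, $b_0\in\mathbb R^m$, $U\subset\mathbb R^d$, $g:\mathbb R^n\times\mathbb R^d\to\mathbb R^n$, $\varphi:\mathbb R^n\to(-\infty,\infty]$ and $\ell:[0,T]\times\mathbb R^{n+mn+m}\times\mathbb R^d\times\mathbb R^{n+mn+m}\to(-\infty,\infty]$. For $a=(a_1,\dots,a_m)\in\mathbb R^{mn}$, $b\in\mathbb R^m$ put $C(a,b)=\{x\in\mathbb R^n:\langle a_i,x\rangle\le b_i,\ i=1,\dots,m\}$ and $F(x,a,b,u)=N(x;C(a,b))-g(x,u)$, where $N(x;C)=\{v:\langle v,y-x\rangle\le0\ \forall y\in C\}$ if $x\in C$ and $N(x;C)=\emptyset$ otherwise. The sweeping control problem $(P)$ is to minimize $$J[x,a,b,u]=\varphi(x(T))+\int_0^T\ell\big(t,x(t),a(t),b(t),u(t),\dot x(t),\dot a(t),\dot b(t)\big)\,dt$$ over the feasible solutions, i.e. the quadruples $(x,a,b,u)$ with $x,a,b\in W^{1,2}$, $u\in L^2$ on $[0,T]$, such that $(x,a,b)(0)=(x_0,a_0,b_0)$,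 $-\dot x(t)\in F(x(t),a(t),b(t),u(t))$ and $u(t)\in U$ for a.e. $t$, $\|a_i(t)\|=1$ and $x(t)\in C(a(t),b(t))$ for all $t\in[0,T]$ and all $i$, and the running cost is integrable. The relaxed problem $(R)$ is to minimize $\widehat J[x,a,b,u]=\varphi(x(T))+\int_0^T\widehat\ell_F(t,x,a,b,u,\dot x,\dot a,\dot b)\,dt$ over all $(x,a,b,u)$ in the same spaces with the same initial values, $\|a_i(t)\|=1$ on $[0,T]$, and finite running cost, where $\ell_F$ equals $\ell$ if $u\in U$ and $-\dot x\in F(x,a,b,u)$ and equals $+\infty$ otherwise, and $\widehat\ell_F(t,x,a,b,\cdot)$ is the largest l.s.c. convex function of $(u,\dot x,\dot a,\dot b)$ majorized by $\ell_F(t,x,a,b,\cdot)$. A quadruple $\bar z=(\bar x,\bar a,\bar b,\bar u)$ is a relaxed intermediate local minimizer (r.i.l.m.) of $(P)$ with radius $\bar\varepsilon>0$ if it is feasible for $(P)$ and for $(R)$, and $J[\bar z]=\widehat J[\bar z]\le\widehat J[x,a,b,u]$ for all $(x,a,b,u)$ feasible for $(R)$ with $\|x-\bar x\|_{W^{1,2}}+\|(a,b)-(\bar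 a,\bar b)\|_{W^{1,2}}+\|u-\bar u\|_{L^2}\le\bar\varepsilon$. **Assumptions.** Let $\bar z$ be an r.i.l.m. with radius $\bar\varepsilon$ such that: * $U$ is compact, and $\dot{\bar a}_i,\dot{\bar b}_i$ are essentially bounded; * $\|g(x_1,u_1)-g(x_2,u_2)\|\le L(\|x_1-x_2\|+\|u_1-u_2\|)$ and $\|g(x,u)\|\le M(1+\|x\|)$ for all $x,x_1,x_2\in\mathbb R^n$, $u,u_1,u_2\in U$, with some $L,M>0$; * there are $v_i\in W^{1,2}([0,T];\mathbb R)$ with $\|\bar a_i(t)-\bar a_i(s)\|\le|v_i(t)-v_i(s)|$ for all $s,t,i$, and a continuous $\vartheta:[0,T]\to\mathbb R$ with $\sup\vartheta<0$ such that for every $t\in[0,T]$ some $x\in\mathbb R^n$ satisfies $\langle\bar a_i(t),x\rangle-\bar b_i(t)<\vartheta(t)$ for all $i$; * $\varphi$ is l.s.c., and there are $\rho>0$ and $c\in\mathbb R$ such that almost every $t\in[0,T]$ is *regular*, meaning that $\ell(t,\cdot)$ is l.s.c. and $\ge c$ on the set of all $(x,a,b,u,\dot x,\dot a,\dot b)$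 with $(x,a,b)$ at distance less than $\rho$ from $(\bar x,\bar a,\bar b)(t)$ (the distance being the largest of the Euclidean distances of the three components), $u\in U$, and arbitrary $(\dot x,\dot a,\dot b)$; * $\dot{\bar x},\dot{\bar a},\dot{\bar b},\bar u$ have (fixed, everywhere defined) representatives of bounded variation on $[0,T]$, and $\bar u(0)\in U$. **Discrete problems.** Let $\Delta_k=\{0=t^k_0<\dots<t^k_{\nu(k)}=T\}$ be partitions with $\nu(k)\ge k$ and $h^k_j:=t^k_{j+1}-t^k_j\le\tilde\nu/\nu(k)$ for a constant $\tilde\nu>0$, whose nodes $t^k_0,\dots,t^k_{\nu(k)-1}$ are regular, and let $\delta_k>0$, $\delta_k\to0$. For $\varepsilon>0$ the problem $(P_k)$ is to minimize, over $x_0,\dots,x_{\nu(k)}$, $a_0,\dots,a_{\nu(k)}$, $b_0,\dots,b_{\nu(k)}$, $u_0,\dots,u_{\nu(k)-1}$, with $h_j=h_j^k$, $t_j=t_j^k$ and $(\dot x_j,\dot a_j,\dot b_j):=\big((x_{j+1},a_{j+1},b_{j+1})-(x_j,a_j,b_j)\big)/h_j$, the cost $$\varphi(x_{\nu(k)})+\sum_{j=0}^{\nu(k)-1}h_j\,\ell(t_j,x_j,a_j,b_j,u_j,\dot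 x_j,\dot a_j,\dot b_j)+\frac12\sum_{j=0}^{\nu(k)-1}\int_{t_j}^{t_{j+1}}\big\|(\dot x_j,\dot a_j,\dot b_j,u_j)-(\dot{\bar x},\dot{\bar a},\dot{\bar b},\bar u)(t)\big\|^2dt$$ subject to $x_{j+1}\in x_j-h_jF(x_j,a_j,b_j,u_j)$ and $u_j\in U$ for $j<\nu(k)$; $x_{\nu(k)}\in C(a_{\nu(k)},b_{\nu(k)})$; given initial values $x_0\in C(a_0,b_0)$, $a_0$, $b_0$ and $u_0=\bar u(0)$; $1-\delta_k\le\|a_{ij}\|\le1+\delta_k$ for the components $a_{ij}\in\mathbb R^n$, $i=1,\dots,m$, of $a_j$, $j=0,\dots,\nu(k)$; and $$\sum_{j}\int_{t_j}^{t_{j+1}}\big\|(x_j,a_j,b_j,u_j)-(\bar x,\bar a,\bar b,\bar u)(t)\big\|^2dt\le\frac\varepsilon2,\qquad\sum_{j}\int_{t_j}^{t_{j+1}}\big\|(\dot x_j,\dot a_j,\dot b_j)-(\dot{\bar x},\dot{\bar a},\dot{\bar b})(t)\big\|^2dt\le\frac\varepsilon2 .$$ **Proposition.** There is $\varepsilon_0\in(0,\bar\varepsilon]$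 such that for every $\varepsilon\in(0,\varepsilon_0]$ and all sequences $(\Delta_k)$, $(\delta_k)$ as above, the problem $(P_k)$ has an optimal solution (a feasible point at which the cost, with values in $(-\infty,\infty]$, is least among all feasible points) for all sufficiently large $k$. -/

import Mathlib

open MeasureTheory Set Filter Topology

noncomputable section

namespace SweepingControl

/-- `ℝⁿ` with the Euclidean norm. -/
abbrev E (n : ℕ) : Type := EuclideanSpace ℝ (Fin n)

/-- `ℝᵐⁿ`, as `m`-tuples of vectors of `ℝⁿ`, with the Euclidean norm. -/
abbrev A (n m : ℕ) : Type := PiLp 2 (fun _ : Fin m => E n)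

/-- The space of the variables `(x, a, b)`, and of their velocities. -/
abbrev XAB (n m : ℕ) : Type := E n × A n m × E m

/-- The square of the Euclidean norm of `(x, a, b)`. -/
def sqNorm {n m : ℕ} (q : XAB n m) : ℝ := ‖q.1‖ ^ 2 + ‖q.2.1‖ ^ 2 + ‖q.2.2‖ ^ 2

/-- The convex polyhedron `C(a, b) = {x | ⟨aᵢ, x⟩ ≤ bᵢ for all i}`. -/
def polyhedron {n m : ℕ} (a : A n m) (b : E m) : Set (E n) :=
  {x | ∀ i, inner ℝ (a i) x ≤ b i}

/-- The normal cone of convex analysis; it is empty at points outside the set. -/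
def normalCone {n : ℕ} (x : E n) (C : Set (E n)) : Set (E n) :=
  {v | x ∈ C ∧ ∀ y ∈ C, inner ℝ v (y - x) ≤ 0}

/-- A function of class `W^{1,2}([0,T]; V)`: it is the integral of the square integrable
function `vel`, a representative of its weak derivative. -/
structure W12 (T : ℝ) (V : Type) [NormedAddCommGroup V] [NormedSpace ℝ V] where
  toFun : ℝ → V
  vel : ℝ → V
  memLp_vel : MemLp vel 2 (volume.restrict (Icc 0 T))
  eq_integral : ∀ t ∈ Icc 0 T, toFun t = toFun 0 + ∫ s in (0 : ℝ)..t, vel s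

/-- The data of the sweeping optimal control problem. The costs take values in `(-∞, ∞]`. -/
structure Data (n m d : ℕ) where
  T : ℝ
  T_pos : 0 < T
  U : Set (E d)
  g : E n → E d → E n
  /-- terminal cost -/
  φ : E n → EReal
  φ_ne_bot : ∀ x, φ x ≠ ⊥
  /-- running cost, with arguments `t` and `((x, a, b), u, (ẋ, ȧ, ḃ))` -/
  ℓ : ℝ → XAB n m × E d × XAB n m → EReal
  ℓ_ne_bot : ∀ t p, ℓ t p ≠ ⊥
  x₀ : E n
  a₀ : A n m
  b₀ : E m

variable {n m d : ℕ}

/-- The velocity mapping `F(x, a, b, u) = N(x; C(a, b)) - g(x, u)`. -/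
def Data.F (P : Data n m d) (q : XAB n m) (u : E d) : Set (E n) :=
  {v | ∃ w ∈ normalCone q.1 (polyhedron q.2.1 q.2.2), v = w - P.g q.1 u}

/-- Quadruples `(x, a, b, u)` in `W^{1,2} × W^{1,2} × W^{1,2} × L²`. -/
structure Quad (P : Data n m d) where
  x : W12 P.T (E n)
  a : W12 P.T (A n m)
  b : W12 P.T (E m)
  u : ℝ → E d
  memLp_u : MemLp u 2 (volume.restrict (Icc 0 P.T))

/-- `(x(t), a(t), b(t))`. -/
def Quad.pos {P : Data n m d} (z : Quad P) (t : ℝ) : XAB n m :=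
  (z.x.toFun t, z.a.toFun t, z.b.toFun t)

/-- `(ẋ(t), ȧ(t), ḃ(t))`. -/
def Quad.vel {P : Data n m d} (z : Quad P) (t : ℝ) : XAB n m :=
  (z.x.vel t, z.a.vel t, z.b.vel t)

/-- The extended-real function `L` has a well-defined finite integral over `[0, T]`. -/
def FiniteIntegral (T : ℝ) (L : ℝ → EReal) : Prop :=
  (∀ᵐ t ∂(volume.restrict (Icc 0 T)), L t ≠ ⊤ ∧ L t ≠ ⊥) ∧
    Integrable (fun t => (L t).toReal) (volume.restrict (Icc 0 T))

/-- The running cost along `z`. -/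
def Quad.run {P : Data n m d} (z : Quad P) (t : ℝ) : EReal :=
  P.ℓ t (z.pos t, z.u t, z.vel t)

/-- The Bolza functional `J`. -/
def Quad.J {P : Data n m d} (z : Quad P) : EReal :=
  P.φ (z.x.toFun P.T) + ((∫ t in Icc 0 P.T, (z.run t).toReal : ℝ) : EReal)

/-- The initial conditions. -/
def Quad.Initial {P : Data n m d} (z : Quad P) : Prop :=
  z.x.toFun 0 = P.x₀ ∧ z.a.toFun 0 = P.a₀ ∧ z.b.toFun 0 = P.b₀

/-- The constraints `‖aᵢ(t)‖ = 1` on `[0, T]`. -/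
def Quad.UnitNormals {P : Data n m d} (z : Quad P) : Prop :=
  ∀ t ∈ Icc 0 P.T, ∀ i, ‖z.a.toFun t i‖ = 1

/-- Feasible solutions of the sweeping control problem `(P)`. -/
structure Quad.Feasible {P : Data n m d} (z : Quad P) : Prop where
  initial : z.Initial
  control : ∀ᵐ t ∂(volume.restrict (Icc 0 P.T)), z.u t ∈ P.U
  inclusion : ∀ᵐ t ∂(volume.restrict (Icc 0 P.T)), -(z.x.vel t) ∈ P.F (z.pos t) (z.u t)
  unit : z.UnitNormals
  mixed : ∀ t ∈ Icc 0 P.T, z.x.toFun t ∈ polyhedron (z.a.toFun t) (z.b.toFun t)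
  cost : FiniteIntegral P.T z.run

/-- The largest lower semicontinuous convex function majorized by `f` (the pointwise supremum
of all such functions; convexity of an extended-real function is convexity of its epigraph). -/
def lscConvexHull {V : Type} [TopologicalSpace V] [AddCommGroup V] [Module ℝ V]
    (f : V → EReal) (z : V) : EReal :=
  sSup {r | ∃ h : V → EReal, LowerSemicontinuous h ∧
    Convex ℝ {p : V × ℝ | h p.1 ≤ (p.2 : EReal)} ∧ (∀ y, h y ≤ f y) ∧ r = h z}

open Classical in
/-- The running cost restricted to the controls `u ∈ U` and velocities `-ẋ ∈ F(x, a, b, u)`,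
extended by `+∞`, as a function of `(u, ẋ, ȧ, ḃ)`. -/
def Data.ℓF (P : Data n m d) (t : ℝ) (q : XAB n m) (p : E d × XAB n m) : EReal :=
  if p.1 ∈ P.U ∧ -p.2.1 ∈ P.F q p.1 then P.ℓ t (q, p.1, p.2) else ⊤

/-- The relaxed running cost along `z`: convexification in `(u, ẋ, ȧ, ḃ)`. -/
def Quad.relaxedRun {P : Data n m d} (z : Quad P) (t : ℝ) : EReal :=
  lscConvexHull (P.ℓF t (z.pos t)) (z.u t, z.vel t)

/-- The relaxed cost functional. -/
def Quad.relaxedJ {P : Data n m d} (z : Quad P) : EReal :=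
  P.φ (z.x.toFun P.T) + ((∫ t in Icc 0 P.T, (z.relaxedRun t).toReal : ℝ) : EReal)

/-- Feasible solutions of the relaxed problem `(R)`. -/
structure Quad.RelaxedFeasible {P : Data n m d} (z : Quad P) : Prop where
  initial : z.Initial
  unit : z.UnitNormals
  cost : FiniteIntegral P.T z.relaxedRun

/-- `‖x - x'‖_{W^{1,2}} + ‖(a, b) - (a', b')‖_{W^{1,2}} + ‖u - u'‖_{L²}`. -/
def Quad.dist {P : Data n m d} (z w : Quad P) : ℝ :=
  Real.sqrt (∫ t in Icc 0 P.T,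
      (‖z.x.toFun t - w.x.toFun t‖ ^ 2 + ‖z.x.vel t - w.x.vel t‖ ^ 2)) +
    Real.sqrt (∫ t in Icc 0 P.T,
      (‖z.a.toFun t - w.a.toFun t‖ ^ 2 + ‖z.b.toFun t - w.b.toFun t‖ ^ 2 +
        ‖z.a.vel t - w.a.vel t‖ ^ 2 + ‖z.b.vel t - w.b.vel t‖ ^ 2)) +
    Real.sqrt (∫ t in Icc 0 P.T, ‖z.u t - w.u t‖ ^ 2)

/-- `z` is a relaxed intermediate local minimizer of `(P)` with radius `ε`. -/
structure Quad.IsRILM {P : Data n m d} (z : Quad P) (ε : ℝ) : Prop where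
  pos : 0 < ε
  feasible : z.Feasible
  relaxedFeasible : z.RelaxedFeasible
  J_eq : z.J = z.relaxedJ
  le : ∀ w : Quad P, w.RelaxedFeasible → w.dist z ≤ ε → z.relaxedJ ≤ w.relaxedJ

/-- The control set is compact. -/
def CompactControls (P : Data n m d) : Prop := IsClosed P.U ∧ Bornology.IsBounded P.U

/-- The derivatives of the moving set controls are essentially bounded. -/
def BoundedDerivatives {P : Data n m d} (z : Quad P) : Prop :=
  ∃ M : ℝ, ∀ᵐ t ∂(volume.restrict (Icc 0 P.T)), ∀ i, ‖z.a.vel t i‖ ≤ M ∧ |z.b.vel t i| ≤ M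

/-- Lipschitz continuity and sublinear growth of the perturbation. -/
def PerturbationRegular (P : Data n m d) : Prop :=
  (∃ L : ℝ, 0 < L ∧ ∀ x₁ x₂, ∀ u₁ ∈ P.U, ∀ u₂ ∈ P.U,
      ‖P.g x₁ u₁ - P.g x₂ u₂‖ ≤ L * (‖x₁ - x₂‖ + ‖u₁ - u₂‖)) ∧
    ∃ M : ℝ, 0 < M ∧ ∀ x, ∀ u ∈ P.U, ‖P.g x u‖ ≤ M * (1 + ‖x‖)

/-- Regularity of the moving normals and the uniform Slater condition. -/
def UniformSlater {P : Data n m d} (z : Quad P) : Prop :=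
  (∃ v : Fin m → W12 P.T ℝ, ∀ i, ∀ s ∈ Icc 0 P.T, ∀ t ∈ Icc 0 P.T,
      ‖z.a.toFun t i - z.a.toFun s i‖ ≤ |(v i).toFun t - (v i).toFun s|) ∧
    ∃ θ : ℝ → ℝ, ContinuousOn θ (Icc 0 P.T) ∧ sSup (θ '' Icc 0 P.T) < 0 ∧
      ∀ t ∈ Icc 0 P.T, ∃ x : E n, ∀ i, inner ℝ (z.a.toFun t i) x - z.b.toFun t i < θ t

/-- The points `((x, a, b), u, (ẋ, ȧ, ḃ))` with `(x, a, b)` at distance less than `ρ` from the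
position of `z` at time `t`, with control in `U` and with arbitrary velocities. -/
def tube {P : Data n m d} (z : Quad P) (ρ t : ℝ) : Set (XAB n m × E d × XAB n m) :=
  {p | dist p.1 (z.pos t) < ρ ∧ p.2.1 ∈ P.U}

/-- At time `t`, the running cost is lower semicontinuous and bounded below by `c`
around `z`. -/
def RunningCostRegularAt {P : Data n m d} (z : Quad P) (ρ c t : ℝ) : Prop :=
  LowerSemicontinuousOn (P.ℓ t) (tube z ρ t) ∧ ∀ p ∈ tube z ρ t, (c : EReal) ≤ P.ℓ t p

/-- Lower semicontinuity of the terminal cost; lower semicontinuity and boundedness from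
below of the running cost around `z`, for almost every time. -/
def CostRegular {P : Data n m d} (z : Quad P) (ρ c : ℝ) : Prop :=
  LowerSemicontinuous P.φ ∧
    ∀ᵐ t ∂(volume.restrict (Icc 0 P.T)), RunningCostRegularAt z ρ c t

/-- `ẋ`, `ȧ`, `ḃ` and `u` have bounded variation on `[0, T]`. -/
def BVQuad {P : Data n m d} (z : Quad P) : Prop :=
  BoundedVariationOn z.x.vel (Icc 0 P.T) ∧ BoundedVariationOn z.a.vel (Icc 0 P.T) ∧
    BoundedVariationOn z.b.vel (Icc 0 P.T) ∧ BoundedVariationOn z.u (Icc 0 P.T)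

/-- A partition `0 = t₀ < t₁ < ⋯ < t_ν = T`. -/
structure Mesh (T : ℝ) where
  ν : ℕ
  t : Fin (ν + 1) → ℝ
  strictMono : StrictMono t
  t_zero : t 0 = 0
  t_last : t (Fin.last ν) = T

/-- The step sizes `hⱼ = tⱼ₊₁ - tⱼ`. -/
def Mesh.h {T : ℝ} (Δ : Mesh T) (j : Fin Δ.ν) : ℝ := Δ.t j.succ - Δ.t j.castSucc

/-- Discrete quadruples `(x₀, …, x_ν, a₀, …, a_ν, b₀, …, b_ν, u₀, …, u_{ν-1})`. -/
structure DiscreteQuad (n m d ν : ℕ) where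
  x : Fin (ν + 1) → E n
  a : Fin (ν + 1) → A n m
  b : Fin (ν + 1) → E m
  u : Fin ν → E d

/-- `(xⱼ, aⱼ, bⱼ)`. -/
def DiscreteQuad.pos {ν : ℕ} (w : DiscreteQuad n m d ν) (j : Fin (ν + 1)) : XAB n m :=
  (w.x j, w.a j, w.b j)

/-- The difference quotients of `(x, a, b)` over the step `j`. -/
def DiscreteQuad.vel {T : ℝ} (Δ : Mesh T) (w : DiscreteQuad n m d Δ.ν) (j : Fin Δ.ν) :
    XAB n m :=
  (Δ.h j)⁻¹ • (w.pos j.succ - w.pos j.castSucc)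

/-- The cost of the discrete problem. -/
def discreteJ {P : Data n m d} (z : Quad P) (Δ : Mesh P.T) (w : DiscreteQuad n m d Δ.ν) :
    EReal :=
  P.φ (w.x (Fin.last Δ.ν)) +
    ∑ j : Fin Δ.ν, (Δ.h j : EReal) *
      P.ℓ (Δ.t j.castSucc) (w.pos j.castSucc, w.u j, w.vel Δ j) +
    (((1 / 2 : ℝ) * ∑ j : Fin Δ.ν, ∫ t in (Δ.t j.castSucc)..(Δ.t j.succ),
      (sqNorm (w.vel Δ j - z.vel t) + ‖w.u j - z.u t‖ ^ 2) : ℝ) : EReal)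

/-- The constraints of the discrete problem. -/
structure DiscreteFeasible {P : Data n m d} (z : Quad P) (ε δ : ℝ) (Δ : Mesh P.T)
    (w : DiscreteQuad n m d Δ.ν) : Prop where
  dynamics : ∀ j : Fin Δ.ν, ∃ v ∈ P.F (w.pos j.castSucc) (w.u j),
    w.x j.succ = w.x j.castSucc - Δ.h j • v
  terminal : w.x (Fin.last Δ.ν) ∈ polyhedron (w.a (Fin.last Δ.ν)) (w.b (Fin.last Δ.ν))
  initial_x : w.x 0 = P.x₀
  initial_mem : P.x₀ ∈ polyhedron P.a₀ P.b₀
  initial_a : w.a 0 = P.a₀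
  initial_b : w.b 0 = P.b₀
  initial_u : ∀ j : Fin Δ.ν, (j : ℕ) = 0 → w.u j = z.u 0
  close : ∑ j : Fin Δ.ν, ∫ t in (Δ.t j.castSucc)..(Δ.t j.succ),
    (sqNorm (w.pos j.castSucc - z.pos t) + ‖w.u j - z.u t‖ ^ 2) ≤ ε / 2
  close_vel : ∑ j : Fin Δ.ν, ∫ t in (Δ.t j.castSucc)..(Δ.t j.succ),
    sqNorm (w.vel Δ j - z.vel t) ≤ ε / 2
  control : ∀ j, w.u j ∈ P.U
  norm_a : ∀ j i, 1 - δ ≤ ‖w.a j i‖ ∧ ‖w.a j i‖ ≤ 1 + δ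

/-- Optimal solutions of the discrete problem. -/
def DiscreteOptimal {P : Data n m d} (z : Quad P) (ε δ : ℝ) (Δ : Mesh P.T)
    (w : DiscreteQuad n m d Δ.ν) : Prop :=
  DiscreteFeasible z ε δ Δ w ∧
    ∀ w', DiscreteFeasible z ε δ Δ w' → discreteJ z Δ w ≤ discreteJ z Δ w'

end SweepingControl

end

open SweepingControl

/-
Existence is Weierstrass' theorem, and its only delicate ingredient is that the feasible set is
nonempty. Along `z` the inclusion holds at a.e. time; taking right limits of the rates (which have
bounded variation) gives a velocity and a control at every node, and the Slater condition closes the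
graph of the normal cone, so the inclusion survives the limit. The Euler polygon with these data
leaves the polyhedra of `z`, but translating them, i.e. moving `b` only, makes the polygon feasible
without touching the normals `aᵢ`. By a discrete Gronwall estimate and bounded variation its
deviation from `z` tends to `0` with the mesh size, so the localization constraints hold.

The velocity constraint keeps feasible points uniformly near `z`, where the Slater condition
persists; there the dynamics are closed and the running cost is lower semicontinuous.
-/

namespace SweepingControl

variable {n m d : ℕ}

/-! ### Meshes -/

lemma le_gronwall_fin {ν : ℕ} {r : Fin (ν + 1) → ℝ} {a b : Fin ν → ℝ} (hr : 0 ≤ r 0)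
    (ha : ∀ j, 0 ≤ a j) (hb : ∀ j, 0 ≤ b j)
    (hstep : ∀ j : Fin ν, r j.succ ≤ (1 + a j) * r j.castSucc + b j) (j : Fin (ν + 1)) :
    r j ≤ (r 0 + ∑ i, b i) * Real.exp (∑ i, a i) := by
  let u (k : ℕ) : ℝ := r ⟨min k ν, by omega⟩
  let A (k : ℕ) : ℝ := if hk : k < ν then a ⟨k, hk⟩ else 0
  let B (k : ℕ) : ℝ := if hk : k < ν then b ⟨k, hk⟩ else 0
  have hA (k : ℕ) : 0 ≤ A k := by unfold A; split_ifs <;> simp [ha]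
  have hB (k : ℕ) : 0 ≤ B k := by unfold B; split_ifs <;> simp [hb]
  have hu (k : ℕ) : u (k + 1) ≤ (1 + A k) * u k + B k := by
    by_cases hk : k < ν
    · simpa [u, A, B, hk, hk.le, Nat.succ_le_of_lt hk] using hstep ⟨k, hk⟩
    · simp [u, A, B, hk, not_lt.1 hk, (not_lt.1 hk).trans k.le_succ]
  have hjν : Finset.Ico 0 (j : ℕ) ⊆ Finset.range ν := fun i hi =>
    Finset.mem_range.2 ((Finset.mem_Ico.1 hi).2.trans_le j.is_le)
  have hsumA : ∑ k ∈ Finset.Ico 0 (j : ℕ), A k ≤ ∑ i, a i :=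
    (Finset.sum_le_sum_of_subset_of_nonneg hjν fun k _ _ => hA k).trans
      (by simp [Finset.sum_range, A])
  have hsumB : ∑ k ∈ Finset.Ico 0 (j : ℕ), B k ≤ ∑ i, b i :=
    (Finset.sum_le_sum_of_subset_of_nonneg hjν fun k _ _ => hB k).trans
      (by simp [Finset.sum_range, B])
  have h := discrete_gronwall (u := u) (n₀ := 0) (by simpa [u] using hr) (fun k _ => hu k)
    (fun k _ => hA k) (fun k _ => hB k) (Nat.zero_le j)
  have huj : u j = r j := by simp [u, j.is_le]
  have hu0 : u 0 = r 0 := by simp [u]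
  rw [huj, hu0] at h
  have hb0 : 0 ≤ ∑ i, b i := Finset.sum_nonneg fun i _ => hb i
  refine h.trans ?_
  gcongr

namespace Mesh

variable {T : ℝ} (Δ : Mesh T)

lemma h_pos (j : Fin Δ.ν) : 0 < Δ.h j :=
  sub_pos.2 (Δ.strictMono Fin.castSucc_lt_succ)

lemma castSucc_le_succ (j : Fin Δ.ν) : Δ.t j.castSucc ≤ Δ.t j.succ :=
  Δ.strictMono.monotone Fin.castSucc_lt_succ.le

lemma t_mem (j : Fin (Δ.ν + 1)) : Δ.t j ∈ Icc 0 T :=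
  ⟨Δ.t_zero.symm.le.trans (Δ.strictMono.monotone (Fin.zero_le j)),
    (Δ.strictMono.monotone (Fin.le_last j)).trans Δ.t_last.le⟩

/-- The `j`-th cell of the mesh. -/
def cell (j : Fin Δ.ν) : Set ℝ := Icc (Δ.t j.castSucc) (Δ.t j.succ)

lemma cell_subset (j : Fin Δ.ν) : Δ.cell j ⊆ Icc 0 T :=
  Icc_subset_Icc (Δ.t_mem _).1 (Δ.t_mem _).2

lemma sum_sub (f : ℝ → ℝ) :
    ∑ j : Fin Δ.ν, (f (Δ.t j.succ) - f (Δ.t j.castSucc)) = f T - f 0 := by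
  have h := Fin.sum_univ_castSucc fun j => f (Δ.t j)
  rw [Fin.sum_univ_succ, Δ.t_last, Δ.t_zero] at h
  rw [Finset.sum_sub_distrib]
  linarith

lemma sum_h : ∑ j, Δ.h j = T := by
  simpa [h] using Δ.sum_sub id

lemma sum_variation {V : Type*} [PseudoEMetricSpace V] {f : ℝ → V}
    (hf : BoundedVariationOn f (Icc 0 T)) :
    ∑ j, (eVariationOn f (Δ.cell j)).toReal = (eVariationOn f (Icc 0 T)).toReal := by
  have hcell (j : Fin Δ.ν) : (eVariationOn f (Δ.cell j)).toReal =
      (eVariationOn f (Icc 0 (Δ.t j.succ))).toReal -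
        (eVariationOn f (Icc 0 (Δ.t j.castSucc))).toReal := by
    have h := eVariationOn.Icc_add_Icc f (Δ.t_mem j.castSucc).1 (Δ.castSucc_le_succ j)
      (mem_univ _)
    simp only [univ_inter] at h
    rw [← h, ENNReal.toReal_add, cell]
    · ring
    · exact hf.mono (Icc_subset_Icc_right (Δ.t_mem _).2)
    · exact hf.mono (Δ.cell_subset j)
  simp only [hcell]
  rw [Δ.sum_sub fun t => (eVariationOn f (Icc 0 t)).toReal]
  simp

lemma eventually_h_le {Δ : ℕ → Mesh T} {C η : ℝ} (hη : 0 < η) (hν : ∀ k, k ≤ (Δ k).ν)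
    (hC : 0 ≤ C) (hh : ∀ k j, (Δ k).h j ≤ C / (Δ k).ν) : ∀ᶠ k in atTop, ∀ j, (Δ k).h j ≤ η := by
  have hlim := tendsto_const_div_atTop_nhds_zero_nat C
  filter_upwards [hlim.eventually_le_const hη, eventually_gt_atTop 0] with k hk hk0 j
  exact (hh k j).trans ((by gcongr; exact hν k : C / ((Δ k).ν : ℝ) ≤ C / k).trans hk)

end Mesh

/-! ### Square integrable functions and functions of class `W^{1,2}` -/

section QuadraticIntegrals

variable {V : Type*} [NormedAddCommGroup V] {Q : V → ℝ} {K : ℝ} {f : ℝ → V}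

lemma norm_sub_sq_le (v w : V) : ‖v - w‖ ^ 2 ≤ 2 * (‖v‖ ^ 2 + ‖w‖ ^ 2) :=
  (pow_le_pow_left₀ (norm_nonneg _) (norm_sub_le v w) 2).trans (add_sq_le)

lemma integrable_comp_sub_of_le_sq {μ : Measure ℝ} [IsFiniteMeasure μ] (hQ : Continuous Q)
    (hQK : ∀ v, ‖Q v‖ ≤ K * ‖v‖ ^ 2) (hf : MemLp f 2 μ) (v : V) :
    Integrable (fun t => Q (v - f t)) μ := by
  have hvf : MemLp (fun t => v - f t) 2 μ := (memLp_const v).sub hf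
  exact (hvf.norm.integrable_sq.const_mul K).mono' (hQ.comp_aestronglyMeasurable hvf.1)
    (Eventually.of_forall fun t => hQK _)

lemma continuous_integral_comp_sub_of_le_sq {μ : Measure ℝ} [IsFiniteMeasure μ]
    (hQ : Continuous Q) (hQK : ∀ v, ‖Q v‖ ≤ K * ‖v‖ ^ 2) (hf : MemLp f 2 μ) :
    Continuous fun v => ∫ t, Q (v - f t) ∂μ := by
  rw [continuous_iff_continuousAt]
  intro v₀
  refine continuousAt_of_dominated
    (bound := fun t => |K| * (2 * ((‖v₀‖ + 1) ^ 2 + ‖f t‖ ^ 2)))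
    (Eventually.of_forall fun v => (integrable_comp_sub_of_le_sq hQ hQK hf v).1) ?_ ?_
    (Eventually.of_forall fun t => by fun_prop)
  · filter_upwards [Metric.ball_mem_nhds v₀ one_pos] with v hv
    have hv' : ‖v‖ ≤ ‖v₀‖ + 1 := by
      linarith [norm_le_norm_add_norm_sub' v v₀, mem_ball_iff_norm.1 hv]
    refine Eventually.of_forall fun t => (hQK _).trans ?_
    calc K * ‖v - f t‖ ^ 2 ≤ |K| * (2 * (‖v‖ ^ 2 + ‖f t‖ ^ 2)) := by
          gcongr
          exacts [le_abs_self K, norm_sub_sq_le _ _]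
      _ ≤ |K| * (2 * ((‖v₀‖ + 1) ^ 2 + ‖f t‖ ^ 2)) := by gcongr
  · exact (((integrable_const _).add hf.norm.integrable_sq).const_mul 2).const_mul |K|

instance isFiniteMeasure_restrict_uIoc (s t : ℝ) : IsFiniteMeasure (volume.restrict (uIoc s t)) :=
  inferInstanceAs (IsFiniteMeasure (volume.restrict (Ioc _ _)))

lemma intervalIntegrable_comp_sub_of_le_sq {s t : ℝ} (hQ : Continuous Q)
    (hQK : ∀ v, ‖Q v‖ ≤ K * ‖v‖ ^ 2) (hf : MemLp f 2 (volume.restrict (uIoc s t))) (v : V) :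
    IntervalIntegrable (fun τ => Q (v - f τ)) volume s t :=
  intervalIntegrable_iff.2 (integrable_comp_sub_of_le_sq hQ hQK hf v)

lemma continuous_intervalIntegral_comp_sub_of_le_sq {s t : ℝ} (hQ : Continuous Q)
    (hQK : ∀ v, ‖Q v‖ ≤ K * ‖v‖ ^ 2) (hf : MemLp f 2 (volume.restrict (uIoc s t))) :
    Continuous fun v => ∫ τ in s..t, Q (v - f τ) := by
  simp only [intervalIntegral.intervalIntegral_eq_integral_uIoc, smul_eq_mul]
  exact continuous_const.mul (continuous_integral_comp_sub_of_le_sq hQ hQK hf)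

lemma intervalIntegrable_norm_sub_sq {s t : ℝ} (hf : MemLp f 2 (volume.restrict (uIoc s t)))
    (v : V) : IntervalIntegrable (fun τ => ‖v - f τ‖ ^ 2) volume s t :=
  intervalIntegrable_iff.2 ((memLp_const v).sub hf).norm.integrable_sq

lemma isBounded_setOf_integral_norm_sub_sq_le {s t : ℝ} (hst : s < t)
    (hf : MemLp f 2 (volume.restrict (uIoc s t))) (C : ℝ) :
    Bornology.IsBounded {v | ∫ τ in s..t, ‖v - f τ‖ ^ 2 ≤ C} := by
  have hint := intervalIntegrable_norm_sub_sq hf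
  have hf' : IntervalIntegrable (fun τ => ‖f τ‖ ^ 2) volume s t :=
    intervalIntegrable_iff.2 hf.norm.integrable_sq
  refine isBounded_iff_forall_norm_le.2
    ⟨√((2 * (C + ∫ τ in s..t, ‖f τ‖ ^ 2)) / (t - s)), fun v hv => Real.le_sqrt_of_sq_le ?_⟩
  rw [le_div_iff₀ (sub_pos.2 hst)]
  calc ‖v‖ ^ 2 * (t - s) = ∫ _ in s..t, ‖v‖ ^ 2 := by simp [mul_comm]
    _ ≤ ∫ τ in s..t, 2 * (‖v - f τ‖ ^ 2 + ‖f τ‖ ^ 2) := by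
        refine intervalIntegral.integral_mono_on hst.le intervalIntegrable_const
          (((hint v).add hf').const_mul 2) fun τ _ => ?_
        simpa using norm_sub_sq_le (v - f τ) (-f τ)
    _ = 2 * ((∫ τ in s..t, ‖v - f τ‖ ^ 2) + ∫ τ in s..t, ‖f τ‖ ^ 2) := by
        rw [intervalIntegral.integral_const_mul, intervalIntegral.integral_add (hint v) hf']
    _ ≤ 2 * (C + ∫ τ in s..t, ‖f τ‖ ^ 2) := by gcongr; exact hv

lemma integral_norm_sub_le_young {s t c : ℝ} (hf : MemLp f 2 (volume.restrict (uIoc s t)))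
    (hst : s ≤ t) (hc : 0 < c) (v : V) :
    ∫ τ in s..t, ‖v - f τ‖ ≤ c / 2 * (t - s) + c⁻¹ / 2 * ∫ τ in s..t, ‖v - f τ‖ ^ 2 := by
  have hvf : MemLp (fun τ => v - f τ) 2 (volume.restrict (uIoc s t)) := (memLp_const v).sub hf
  have hsq := intervalIntegrable_norm_sub_sq hf v
  have hyoung (x : ℝ) : x ≤ c / 2 + c⁻¹ / 2 * x ^ 2 := by
    have : 0 ≤ c⁻¹ / 2 * (x - c) ^ 2 := by positivity
    have e : c⁻¹ / 2 * (x - c) ^ 2 = c / 2 + c⁻¹ / 2 * x ^ 2 - x := by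
      field_simp
      ring
    linarith
  calc ∫ τ in s..t, ‖v - f τ‖ ≤ ∫ τ in s..t, (c / 2 + c⁻¹ / 2 * ‖v - f τ‖ ^ 2) :=
        intervalIntegral.integral_mono_on hst
          (intervalIntegrable_iff.2 (hvf.norm.integrable one_le_two))
          (intervalIntegrable_const.add (hsq.const_mul _)) fun τ _ => hyoung _
    _ = _ := by
        rw [intervalIntegral.integral_add intervalIntegrable_const (hsq.const_mul _),
          intervalIntegral.integral_const, intervalIntegral.integral_const_mul, smul_eq_mul,
          mul_comm (t - s)]

lemma memLp_restrict_uIoc {T s t : ℝ} (hf : MemLp f 2 (volume.restrict (Icc 0 T)))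
    (hs : s ∈ Icc 0 T) (ht : t ∈ Icc 0 T) : MemLp f 2 (volume.restrict (uIoc s t)) :=
  hf.mono_measure (Measure.restrict_mono
    (uIoc_subset_uIcc.trans (uIcc_subset_Icc hs ht)) le_rfl)

lemma Mesh.continuous_sum_integral_comp_sub_of_le_sq {T : ℝ} (Δ : Mesh T) (hQ : Continuous Q)
    (hQK : ∀ v, ‖Q v‖ ≤ K * ‖v‖ ^ 2) (hf : MemLp f 2 (volume.restrict (Icc 0 T)))
    {X : Type*} [TopologicalSpace X] {p : Fin Δ.ν → X → V} (hp : ∀ j, Continuous (p j)) :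
    Continuous fun x => ∑ j, ∫ t in (Δ.t j.castSucc)..(Δ.t j.succ), Q (p j x - f t) :=
  continuous_finsetSum _ fun j _ => (continuous_intervalIntegral_comp_sub_of_le_sq hQ hQK
    (memLp_restrict_uIoc hf (Δ.t_mem _) (Δ.t_mem _))).comp (hp j)

end QuadraticIntegrals

namespace W12

variable {T : ℝ} {V : Type} [NormedAddCommGroup V] [NormedSpace ℝ V]

lemma intervalIntegrable_vel (f : W12 T V) {s t : ℝ} (hs : s ∈ Icc 0 T) (ht : t ∈ Icc 0 T) :
    IntervalIntegrable f.vel volume s t :=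
  intervalIntegrable_iff.2 ((memLp_restrict_uIoc f.memLp_vel hs ht).integrable one_le_two)

lemma integral_vel (f : W12 T V) {s t : ℝ} (hs : s ∈ Icc 0 T) (ht : t ∈ Icc 0 T) :
    ∫ τ in s..t, f.vel τ = f.toFun t - f.toFun s := by
  have h0 : (0 : ℝ) ∈ Icc 0 T := left_mem_Icc.2 (hs.1.trans hs.2)
  rw [f.eq_integral t ht, f.eq_integral s hs, add_sub_add_left_eq_sub,
    intervalIntegral.integral_interval_sub_left (f.intervalIntegrable_vel h0 ht)
      (f.intervalIntegrable_vel h0 hs)]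

lemma continuousOn (f : W12 T V) : ContinuousOn f.toFun (Icc 0 T) := by
  rcases lt_or_ge T 0 with hT | hT
  · simp [Icc_eq_empty_of_lt hT]
  have hprim := intervalIntegral.continuousOn_primitive_interval'
    (f.intervalIntegrable_vel (left_mem_Icc.2 hT) (right_mem_Icc.2 hT)) left_mem_uIcc
  rw [uIcc_of_le hT] at hprim
  exact (continuousOn_const.add hprim).congr f.eq_integral

lemma memLp (f : W12 T V) : MemLp f.toFun 2 (volume.restrict (Icc 0 T)) := by
  obtain ⟨C, hC⟩ := isCompact_Icc.exists_bound_of_continuousOn f.continuousOn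
  exact MemLp.of_bound (f.continuousOn.aestronglyMeasurable_of_isCompact isCompact_Icc
    measurableSet_Icc) C (ae_restrict_of_forall_mem measurableSet_Icc hC)

lemma norm_sub_le_mul (f : W12 T V) {B s t : ℝ} (hB : ∀ τ ∈ Icc 0 T, ‖f.vel τ‖ ≤ B)
    (hs : s ∈ Icc 0 T) (ht : t ∈ Icc 0 T) : ‖f.toFun t - f.toFun s‖ ≤ B * |t - s| := by
  rw [← f.integral_vel hs ht]
  exact intervalIntegral.norm_integral_le_of_norm_le_const fun τ hτ =>
    hB τ (uIcc_subset_Icc hs ht (uIoc_subset_uIcc hτ))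

variable [CompleteSpace V]

lemma integral_const_sub_vel (f : W12 T V) {s t : ℝ} (hs : s ∈ Icc 0 T) (ht : t ∈ Icc 0 T)
    (v : V) : ∫ τ in s..t, (v - f.vel τ) = (t - s) • v - (f.toFun t - f.toFun s) := by
  rw [intervalIntegral.integral_sub intervalIntegrable_const (f.intervalIntegrable_vel hs ht),
    intervalIntegral.integral_const, f.integral_vel hs ht]

lemma norm_slope_sub_le (f : W12 T V) {s t C : ℝ} (hs : s ∈ Icc 0 T) (ht : t ∈ Icc 0 T)
    (hst : s < t) {v : V} (hv : ∀ τ ∈ Icc s t, ‖v - f.vel τ‖ ≤ C) :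
    ‖(t - s)⁻¹ • (f.toFun t - f.toFun s) - v‖ ≤ C := by
  have hts : 0 < t - s := sub_pos.2 hst
  have hint : ‖∫ τ in s..t, (v - f.vel τ)‖ ≤ C * (t - s) := by
    rw [← abs_of_pos hts]
    exact intervalIntegral.norm_integral_le_of_norm_le_const fun τ hτ =>
      hv τ (Ioc_subset_Icc_self (uIoc_of_le hst.le ▸ hτ))
  have hslope : (t - s)⁻¹ • (f.toFun t - f.toFun s) - v =
      -((t - s)⁻¹ • ∫ τ in s..t, (v - f.vel τ)) := by
    rw [f.integral_const_sub_vel hs ht, smul_sub _ ((t - s) • v), inv_smul_smul₀ hts.ne', neg_sub]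
  rw [hslope, norm_neg, norm_smul, Real.norm_of_nonneg (inv_nonneg.2 hts.le),
    inv_mul_le_iff₀ hts, mul_comm]
  exact hint

lemma norm_sub_le_sum_integral (f : W12 T V) (Δ : Mesh T) {w : Fin (Δ.ν + 1) → V}
    (hw : w 0 = f.toFun 0) (j : Fin (Δ.ν + 1)) :
    ‖w j - f.toFun (Δ.t j)‖ ≤ ∑ i : Fin Δ.ν, ∫ τ in (Δ.t i.castSucc)..(Δ.t i.succ),
      ‖(Δ.h i)⁻¹ • (w i.succ - w i.castSucc) - f.vel τ‖ := by
  have hstep (i : Fin Δ.ν) : ‖w i.succ - f.toFun (Δ.t i.succ)‖ ≤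
      ‖w i.castSucc - f.toFun (Δ.t i.castSucc)‖ + ∫ τ in (Δ.t i.castSucc)..(Δ.t i.succ),
        ‖(Δ.h i)⁻¹ • (w i.succ - w i.castSucc) - f.vel τ‖ := by
    have hincrement : w i.succ - f.toFun (Δ.t i.succ) =
        w i.castSucc - f.toFun (Δ.t i.castSucc) + ∫ τ in (Δ.t i.castSucc)..(Δ.t i.succ),
          ((Δ.h i)⁻¹ • (w i.succ - w i.castSucc) - f.vel τ) := by
      rw [f.integral_const_sub_vel (Δ.t_mem _) (Δ.t_mem _), ← Mesh.h,
        smul_inv_smul₀ (Δ.h_pos i).ne']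
      abel
    rw [hincrement]
    refine (norm_add_le _ _).trans ?_
    gcongr
    exact intervalIntegral.norm_integral_le_integral_norm (Δ.castSucc_le_succ i)
  have h := le_gronwall_fin (r := fun j => ‖w j - f.toFun (Δ.t j)‖) (a := 0) (norm_nonneg _)
    (fun _ => le_rfl)
    (fun i => intervalIntegral.integral_nonneg (Δ.castSucc_le_succ i) fun _ _ => norm_nonneg _)
    (fun i => by simpa using hstep i) j
  simpa [Δ.t_zero, hw] using h

lemma norm_sub_lt_of_sum_integral_le (f : W12 T V) {r ε : ℝ} (hT : 0 < T) (hr : 0 < r)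
    (hε : ε ≤ r ^ 2 / T) (Δ : Mesh T) {w : Fin (Δ.ν + 1) → V} (hw : w 0 = f.toFun 0)
    (hclose : ∑ j : Fin Δ.ν, ∫ τ in (Δ.t j.castSucc)..(Δ.t j.succ),
      ‖(Δ.h j)⁻¹ • (w j.succ - w j.castSucc) - f.vel τ‖ ^ 2 ≤ ε / 2) (j : Fin (Δ.ν + 1)) :
    ‖w j - f.toFun (Δ.t j)‖ < r := by
  have hcell (i : Fin Δ.ν) := integral_norm_sub_le_young
    (memLp_restrict_uIoc f.memLp_vel (Δ.t_mem i.castSucc) (Δ.t_mem i.succ))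
    (Δ.castSucc_le_succ i) (div_pos hr hT) ((Δ.h i)⁻¹ • (w i.succ - w i.castSucc))
  calc ‖w j - f.toFun (Δ.t j)‖ ≤ _ := f.norm_sub_le_sum_integral Δ hw j
    _ ≤ _ := Finset.sum_le_sum fun i _ => hcell i
    _ = r / T / 2 * T + (r / T)⁻¹ / 2 * ∑ i : Fin Δ.ν,
        ∫ τ in (Δ.t i.castSucc)..(Δ.t i.succ),
          ‖(Δ.h i)⁻¹ • (w i.succ - w i.castSucc) - f.vel τ‖ ^ 2 := by
        have hT : ∑ i : Fin Δ.ν, (Δ.t i.succ - Δ.t i.castSucc) = T := Δ.sum_h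
        rw [Finset.sum_add_distrib, ← Finset.mul_sum, ← Finset.mul_sum, hT]
    _ ≤ r / T / 2 * T + (r / T)⁻¹ / 2 * (r ^ 2 / T / 2) := by
        gcongr
        exact hclose.trans (by gcongr)
    _ < r := by
        have : r / T / 2 * T + (r / T)⁻¹ / 2 * (r ^ 2 / T / 2) = 3 / 4 * r := by
          field_simp
          ring
        linarith

end W12

/-! ### Rates of bounded variation -/

lemma eVariationOn_prodMk_le {V W : Type*} [PseudoEMetricSpace V] [PseudoEMetricSpace W]
    (f : ℝ → V) (g : ℝ → W) (s : Set ℝ) :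
    eVariationOn (fun t => (f t, g t)) s ≤ eVariationOn f s + eVariationOn g s := by
  refine iSup_le fun ⟨k, u, hu, hus⟩ => ?_
  calc ∑ i ∈ Finset.range k, edist (f (u (i + 1)), g (u (i + 1))) (f (u i), g (u i))
      ≤ ∑ i ∈ Finset.range k, (edist (f (u (i + 1))) (f (u i)) +
          edist (g (u (i + 1))) (g (u i))) :=
        Finset.sum_le_sum fun i _ => max_le_add_of_nonneg zero_le zero_le
    _ ≤ eVariationOn f s + eVariationOn g s := by
        rw [Finset.sum_add_distrib]
        exact add_le_add (eVariationOn.sum_le hu hus) (eVariationOn.sum_le hu hus)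

lemma boundedVariationOn_prodMk {V W : Type*} [PseudoEMetricSpace V] [PseudoEMetricSpace W]
    {f : ℝ → V} {g : ℝ → W} {s : Set ℝ} (hf : BoundedVariationOn f s)
    (hg : BoundedVariationOn g s) : BoundedVariationOn (fun t => (f t, g t)) s :=
  ((eVariationOn_prodMk_le f g s).trans_lt (ENNReal.add_lt_top.2 ⟨hf.lt_top, hg.lt_top⟩)).ne

lemma Mesh.sum_integral_le {T : ℝ} (Δ : Mesh T) {η C : ℝ} {ω : Fin Δ.ν → ℝ}
    {F : Fin Δ.ν → ℝ → ℝ} (hη : 0 ≤ η) (hη1 : η ≤ 1) (hC : 0 ≤ C) (hω : ∀ j, 0 ≤ ω j)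
    (hh : ∀ j, Δ.h j ≤ η) (hF : ∀ j, ∀ τ ∈ Δ.cell j, ‖F j τ‖ ≤ C * (η + ω j) ^ 2) :
    ∑ j, ∫ τ in (Δ.t j.castSucc)..(Δ.t j.succ), F j τ ≤
      2 * C * (T + (∑ j, ω j) ^ 2) * η := by
  have hcell (j : Fin Δ.ν) : ∫ τ in (Δ.t j.castSucc)..(Δ.t j.succ), F j τ ≤
      2 * C * η * (Δ.h j + ω j ^ 2) := by
    have hint := intervalIntegral.norm_integral_le_of_norm_le_const fun τ hτ =>
      hF j τ (Ioc_subset_Icc_self (uIoc_of_le (Δ.castSucc_le_succ j) ▸ hτ))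
    rw [abs_of_pos (sub_pos.2 (Δ.strictMono Fin.castSucc_lt_succ)), ← h] at hint
    have hη2 : η ^ 2 ≤ η := pow_le_of_le_one hη hη1 two_ne_zero
    have hωj : Δ.h j * ω j ^ 2 ≤ η * ω j ^ 2 := by gcongr; exact hh j
    have hηj : Δ.h j * η ^ 2 ≤ Δ.h j * η := by gcongr; exact (Δ.h_pos j).le
    calc _ ≤ C * (η + ω j) ^ 2 * Δ.h j := (le_abs_self _).trans hint
      _ ≤ C * (2 * (η ^ 2 + ω j ^ 2)) * Δ.h j := by
          have := (Δ.h_pos j).le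
          gcongr
          exact add_sq_le
      _ = 2 * C * (Δ.h j * η ^ 2 + Δ.h j * ω j ^ 2) := by ring
      _ ≤ 2 * C * (Δ.h j * η + η * ω j ^ 2) := by gcongr
      _ = 2 * C * η * (Δ.h j + ω j ^ 2) := by ring
  have hsq : ∑ j, ω j ^ 2 ≤ (∑ j, ω j) ^ 2 := Finset.sum_sq_le_sq_sum_of_nonneg fun j _ => hω j
  calc _ ≤ ∑ j, 2 * C * η * (Δ.h j + ω j ^ 2) := Finset.sum_le_sum fun j _ => hcell j
    _ = 2 * C * η * (T + ∑ j, ω j ^ 2) := by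
        rw [← Finset.mul_sum, Finset.sum_add_distrib, Δ.sum_h]
    _ ≤ 2 * C * η * (T + (∑ j, ω j) ^ 2) := by gcongr
    _ = _ := by ring

lemma norm_sq_le_sqNorm (q : XAB n m) : ‖q‖ ^ 2 ≤ sqNorm q := by
  have h (x y : ℝ) : max x y ^ 2 ≤ x ^ 2 + y ^ 2 := by
    rcases max_choice x y with h | h <;> rw [h] <;> nlinarith
  have h₁ := h ‖q.1‖ ‖q.2‖
  have h₂ := h ‖q.2.1‖ ‖q.2.2‖
  rw [← Prod.norm_def] at h₁ h₂
  rw [sqNorm]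
  linarith

lemma norm_sqNorm_le (q : XAB n m) : ‖sqNorm q‖ ≤ 3 * ‖q‖ ^ 2 := by
  have h₁ := pow_le_pow_left₀ (norm_nonneg _) (norm_fst_le q) 2
  have h₂ := pow_le_pow_left₀ (norm_nonneg _) ((norm_fst_le q.2).trans (norm_snd_le q)) 2
  have h₃ := pow_le_pow_left₀ (norm_nonneg _) ((norm_snd_le q.2).trans (norm_snd_le q)) 2
  rw [Real.norm_of_nonneg ((sq_nonneg _).trans (norm_sq_le_sqNorm q)), sqNorm]
  linarith

lemma continuous_sqNorm : Continuous (sqNorm (n := n) (m := m)) := by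
  unfold sqNorm
  fun_prop

/-- The square of the Euclidean norm of `((x, a, b), u)`, the integrand of the localization
and penalty terms of the discrete problem. -/
noncomputable def energy (p : XAB n m × E d) : ℝ := sqNorm p.1 + ‖p.2‖ ^ 2

lemma norm_energy_le (p : XAB n m × E d) : ‖energy p‖ ≤ 4 * ‖p‖ ^ 2 := by
  have h₁ := pow_le_pow_left₀ (norm_nonneg _) (norm_fst_le p) 2
  have h₂ := pow_le_pow_left₀ (norm_nonneg _) (norm_snd_le p) 2
  have h₃ := (norm_add_le _ _).trans (add_le_add_left (norm_sqNorm_le p.1) (‖‖p.2‖ ^ 2‖))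
  rw [norm_pow, norm_norm] at h₃
  rw [energy]
  linarith

lemma continuous_energy : Continuous (energy (n := n) (m := m) (d := d)) :=
  (continuous_sqNorm.comp continuous_fst).add (continuous_snd.norm.pow 2)

namespace Quad

variable {P : Data n m d} (z : Quad P)

/-- The curve `t ↦ (x(t), a(t), b(t))` as a single function of class `W^{1,2}`. -/
def trajectory : W12 P.T (XAB n m) where
  toFun := z.pos
  vel := z.vel
  memLp_vel := MemLp.of_fst_snd ⟨z.x.memLp_vel, MemLp.of_fst_snd ⟨z.a.memLp_vel, z.b.memLp_vel⟩⟩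
  eq_integral t ht := by
    have h0 : (0 : ℝ) ∈ Icc 0 P.T := left_mem_Icc.2 P.T_pos.le
    have hab : Integrable (fun τ => (z.a.vel τ, z.b.vel τ)) (volume.restrict (Ioc 0 t)) :=
      ((z.a.intervalIntegrable_vel h0 ht).1).prodMk (z.b.intervalIntegrable_vel h0 ht).1
    simp only [Quad.pos, Quad.vel, intervalIntegral.integral_of_le ht.1]
    rw [integral_pair (z.x.intervalIntegrable_vel h0 ht).1 hab,
      integral_pair (z.a.intervalIntegrable_vel h0 ht).1 (z.b.intervalIntegrable_vel h0 ht).1]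
    simp only [← intervalIntegral.integral_of_le ht.1, Prod.mk_add_mk, ← z.x.eq_integral t ht,
      ← z.a.eq_integral t ht, ← z.b.eq_integral t ht]

/-- The rates `(ẋ, ȧ, ḃ, u)` that enter the penalty term. -/
def rate (t : ℝ) : XAB n m × E d := (z.vel t, z.u t)

lemma memLp_pos_u : MemLp (fun t => (z.pos t, z.u t)) 2 (volume.restrict (Icc 0 P.T)) :=
  MemLp.of_fst_snd ⟨z.trajectory.memLp, z.memLp_u⟩

lemma memLp_rate : MemLp z.rate 2 (volume.restrict (Icc 0 P.T)) :=
  MemLp.of_fst_snd ⟨z.trajectory.memLp_vel, z.memLp_u⟩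

end Quad

lemma BVQuad.boundedVariationOn_rate {P : Data n m d} {z : Quad P} (h : BVQuad z) :
    BoundedVariationOn z.rate (Icc 0 P.T) :=
  boundedVariationOn_prodMk
    (boundedVariationOn_prodMk h.1 (boundedVariationOn_prodMk h.2.1 h.2.2.1)) h.2.2.2

/-! ### Normal cones to moving polyhedra -/

/-- The Slater condition for the polyhedron `C(a, b)`. -/
def Slater (a : A n m) (b : E m) : Prop := ∃ x : E n, ∀ i, inner ℝ (a i) x < b i

lemma isOpen_setOf_slater : IsOpen {p : A n m × E m | Slater p.1 p.2} := by
  simp only [Slater, ofPred_exists, ofPred_forall]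
  refine isOpen_iUnion fun x => isOpen_iInter_of_finite fun i => isOpen_lt ?_ ?_ <;> fun_prop

lemma isClosed_setOf_mem_polyhedron :
    IsClosed {q : XAB n m | q.1 ∈ polyhedron q.2.1 q.2.2} := by
  have h : {q : XAB n m | q.1 ∈ polyhedron q.2.1 q.2.2} =
      ⋂ i, {q | inner ℝ (q.2.1 i) q.1 ≤ q.2.2 i} := by ext; simp [polyhedron]
  rw [h]
  refine isClosed_iInter fun i => isClosed_le ?_ ?_ <;> fun_prop

lemma eventually_mem_polyhedron {ι : Type*} {l : Filter ι} {a : ι → A n m} {b : ι → E m}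
    {a' : A n m} {b' : E m} {y : E n} (ha : Tendsto a l (𝓝 a')) (hb : Tendsto b l (𝓝 b'))
    (hy : ∀ i, inner ℝ (a' i) y < b' i) : ∀ᶠ k in l, y ∈ polyhedron (a k) (b k) := by
  have hopen : IsOpen {p : A n m × E m | ∀ i, inner ℝ (p.1 i) y < p.2 i} := by
    simp only [ofPred_forall]
    refine isOpen_iInter_of_finite fun i => isOpen_lt ?_ ?_ <;> fun_prop
  filter_upwards [(ha.prodMk_nhds hb).eventually_mem (hopen.mem_nhds hy)] with k hk i
  exact (hk i).le

lemma inner_add_smul_sub_lt {a : A n m} {b : E m} {p y : E n}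
    (hp : ∀ i, inner ℝ (a i) p < b i) (hy : y ∈ polyhedron a b) {s : ℝ} (hs : s ∈ Ioc (0 : ℝ) 1)
    (i : Fin m) : inner ℝ (a i) (y + s • (p - y)) < b i := by
  have hyi : inner ℝ (a i) y ≤ b i := hy i
  rw [inner_add_right, inner_smul_right, inner_sub_right]
  nlinarith [hp i, hs.1, hs.2]

/-- Points of `C(a', b')` need not be limits of points of `C(a, b)` in general; those on a segment
to a Slater point are. -/
lemma mem_normalCone_of_tendsto {ι : Type*} {l : Filter ι} [l.NeBot] {q : ι → XAB n m}
    {v : ι → E n} {q' : XAB n m} {v' : E n} (hq : Tendsto q l (𝓝 q')) (hv : Tendsto v l (𝓝 v'))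
    (hslater : Slater q'.2.1 q'.2.2)
    (h : ∀ᶠ k in l, v k ∈ normalCone (q k).1 (polyhedron (q k).2.1 (q k).2.2)) :
    v' ∈ normalCone q'.1 (polyhedron q'.2.1 q'.2.2) := by
  have hx : Tendsto (fun k => (q k).1) l (𝓝 q'.1) := hq.fst_nhds
  refine ⟨isClosed_setOf_mem_polyhedron.mem_of_tendsto hq (h.mono fun k hk => hk.1),
    fun y hy => ?_⟩
  obtain ⟨p, hp⟩ := hslater
  have hsegment (s : ℝ) (hs : s ∈ Ioc (0 : ℝ) 1) :
      inner ℝ v' (y + s • (p - y) - q'.1) ≤ 0 := by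
    refine le_of_tendsto (hv.inner (tendsto_const_nhds.sub hx)) ?_
    filter_upwards [h, eventually_mem_polyhedron hq.snd_nhds.fst_nhds hq.snd_nhds.snd_nhds
      (inner_add_smul_sub_lt hp hy hs)] with k hk hmem using hk.2 _ hmem
  have hlim : Tendsto (fun s : ℝ => (inner ℝ v' (y + s • (p - y) - q'.1) : ℝ)) (𝓝[>] 0)
      (𝓝 (inner ℝ v' (y + (0 : ℝ) • (p - y) - q'.1))) :=
    (Continuous.tendsto (by fun_prop) 0).mono_left nhdsWithin_le_nhds
  rw [zero_smul, add_zero] at hlim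
  exact le_of_tendsto hlim (eventually_of_mem (Ioc_mem_nhdsGT one_pos) hsegment)

/-- The vector of the inner products `⟨aᵢ, y⟩`: moving `b` by `pairing a y` translates the
polyhedron `C(a, b)` by `y`. -/
noncomputable def pairing (a : A n m) (y : E n) : E m := WithLp.toLp 2 fun i => inner ℝ (a i) y

lemma pairing_apply (a : A n m) (y : E n) (i : Fin m) : pairing a y i = inner ℝ (a i) y := rfl

lemma norm_pairing_le (a : A n m) (y : E n) : ‖pairing a y‖ ≤ ‖a‖ * ‖y‖ := by
  refine le_of_sq_le_sq ?_ (by positivity)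
  rw [mul_pow, EuclideanSpace.norm_sq_eq, PiLp.norm_sq_eq_of_L2, Finset.sum_mul]
  refine Finset.sum_le_sum fun i _ => ?_
  rw [← mul_pow]
  exact pow_le_pow_left₀ (norm_nonneg _) (norm_inner_le_norm _ _) 2

lemma pairing_sub_pairing (a a' : A n m) (y y' : E n) :
    pairing a' y' - pairing a y = pairing a' (y' - y) + pairing (a' - a) y := by
  ext i
  simp only [pairing_apply, PiLp.sub_apply, PiLp.add_apply, inner_sub_left, inner_sub_right]
  ring

lemma smul_pairing (c : ℝ) (a : A n m) (y : E n) : c • pairing a y = pairing a (c • y) := by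
  ext i
  simp [pairing_apply, inner_smul_right]

lemma pairing_smul (c : ℝ) (a : A n m) (y : E n) : c • pairing a y = pairing (c • a) y := by
  ext i
  simp [pairing_apply, inner_smul_left]

lemma mem_polyhedron_add_pairing {a : A n m} {b : E m} {y p : E n} :
    p ∈ polyhedron a (b + pairing a y) ↔ p - y ∈ polyhedron a b :=
  forall_congr' fun i => by
    rw [PiLp.add_apply, pairing_apply, inner_sub_right, sub_le_iff_le_add]

lemma mem_normalCone_add_pairing {a : A n m} {b : E m} {x y v : E n}
    (hv : v ∈ normalCone x (polyhedron a b)) :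
    v ∈ normalCone (x + y) (polyhedron a (b + pairing a y)) := by
  refine ⟨mem_polyhedron_add_pairing.2 (by simpa using hv.1), fun p hp => ?_⟩
  rw [sub_add_eq_sub_sub_swap]
  exact hv.2 _ (mem_polyhedron_add_pairing.1 hp)

namespace Data

variable {P : Data n m d}

lemma mem_F {q : XAB n m} {u : E d} {v : E n} :
    v ∈ P.F q u ↔ v + P.g q.1 u ∈ normalCone q.1 (polyhedron q.2.1 q.2.2) := by
  simp [F, eq_sub_iff_add_eq]

lemma mem_F_of_tendsto (hg : ContinuousOn (Function.uncurry P.g) (univ ×ˢ P.U))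
    {ι : Type*} {l : Filter ι} [l.NeBot] {q : ι → XAB n m} {u : ι → E d} {v : ι → E n}
    {q' : XAB n m} {u' : E d} {v' : E n} (hq : Tendsto q l (𝓝 q')) (hu : Tendsto u l (𝓝 u'))
    (hv : Tendsto v l (𝓝 v')) (hslater : Slater q'.2.1 q'.2.2) (hu' : u' ∈ P.U)
    (hU : ∀ᶠ k in l, u k ∈ P.U) (h : ∀ᶠ k in l, v k ∈ P.F (q k) (u k)) : v' ∈ P.F q' u' := by
  have hqu : Tendsto (fun k => ((q k).1, u k)) l (𝓝[univ ×ˢ P.U] (q'.1, u')) :=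
    tendsto_nhdsWithin_iff.2 ⟨hq.fst_nhds.prodMk_nhds hu, hU.mono fun k hk => ⟨trivial, hk⟩⟩
  have hgu : Tendsto (fun k => P.g (q k).1 (u k)) l (𝓝 (P.g q'.1 u')) :=
    (hg (q'.1, u') ⟨trivial, hu'⟩).tendsto.comp hqu
  rw [mem_F]
  exact mem_normalCone_of_tendsto hq (hv.add hgu) hslater (h.mono fun k hk => mem_F.1 hk)

lemma norm_g_sub_g_le {L : NNReal} (hg : LipschitzOnWith L (Function.uncurry P.g) (univ ×ˢ P.U))
    {x x' : E n} {u u' : E d} (hu : u ∈ P.U) (hu' : u' ∈ P.U) :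
    ‖P.g x u - P.g x' u'‖ ≤ L * max ‖x - x'‖ ‖u - u'‖ := by
  have h := hg.norm_sub_le (x := (x, u)) (y := (x', u')) ⟨trivial, hu⟩ ⟨trivial, hu'⟩
  rwa [Prod.mk_sub_mk, Prod.norm_mk] at h

end Data

lemma PerturbationRegular.exists_lipschitzOnWith {P : Data n m d} (h : PerturbationRegular P) :
    ∃ L, LipschitzOnWith L (Function.uncurry P.g) (univ ×ˢ P.U) := by
  obtain ⟨⟨L, hL, hg⟩, -⟩ := h
  refine ⟨(2 * L).toNNReal, LipschitzOnWith.of_dist_le_mul ?_⟩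
  rintro ⟨x₁, u₁⟩ ⟨-, hu₁⟩ ⟨x₂, u₂⟩ ⟨-, hu₂⟩
  rw [Prod.dist_eq, Real.coe_toNNReal _ (by positivity), dist_eq_norm]
  calc ‖P.g x₁ u₁ - P.g x₂ u₂‖ ≤ L * (dist x₁ x₂ + dist u₁ u₂) := by
        simpa only [dist_eq_norm] using hg x₁ x₂ u₁ hu₁ u₂ hu₂
    _ ≤ L * (max (dist x₁ x₂) (dist u₁ u₂) + max (dist x₁ x₂) (dist u₁ u₂)) := by
        gcongr
        exacts [le_max_left _ _, le_max_right _ _]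
    _ = 2 * L * max (dist x₁ x₂) (dist u₁ u₂) := by ring

lemma UniformSlater.slater {P : Data n m d} {z : Quad P} (h : UniformSlater z) {t : ℝ}
    (ht : t ∈ Icc 0 P.T) : Slater (z.a.toFun t) (z.b.toFun t) := by
  obtain ⟨-, θ, hθ, hneg, hslater⟩ := h
  obtain ⟨x, hx⟩ := hslater t ht
  have hθt : θ t ≤ sSup (θ '' Icc 0 P.T) :=
    le_csSup (isCompact_Icc.image_of_continuousOn hθ).bddAbove (mem_image_of_mem _ ht)
  exact ⟨x, fun i => by linarith [hx i]⟩

lemma Quad.exists_slater_radius {P : Data n m d} (z : Quad P)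
    (hslater : ∀ t ∈ Icc 0 P.T, Slater (z.a.toFun t) (z.b.toFun t)) :
    ∃ r > 0, ∀ t ∈ Icc 0 P.T, ∀ q : XAB n m, ‖q - z.pos t‖ < r → Slater q.2.1 q.2.2 := by
  obtain ⟨r, hr, hsub⟩ := (isCompact_Icc.image_of_continuousOn
    z.trajectory.continuousOn).exists_thickening_subset_open
    (isOpen_setOf_slater.preimage continuous_snd) (by rintro _ ⟨t, ht, rfl⟩; exact hslater t ht)
  refine ⟨r, hr, fun t ht q hq => hsub (Metric.mem_thickening_iff.2 ?_)⟩
  exact ⟨z.pos t, mem_image_of_mem _ ht, by rwa [dist_eq_norm]⟩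

/-! ### Admissible velocities and controls at the nodes -/

lemma frequently_nhdsGT_of_ae_Icc {s T : ℝ} {p : ℝ → Prop}
    (hp : ∀ᵐ t ∂(volume.restrict (Icc 0 T)), p t) (hs : s ∈ Ico 0 T) : ∃ᶠ t in 𝓝[>] s, p t := by
  refine (nhdsGT_basis s).frequently_iff.2 fun r hr => ?_
  have hdense := Measure.dense_of_ae ((ae_restrict_iff' measurableSet_Icc).1 hp)
  obtain ⟨t, hpt, ht⟩ := hdense.exists_between (lt_min hr hs.2)
  exact ⟨t, ⟨ht.1, ht.2.trans_le (min_le_left _ _)⟩,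
    hpt ⟨hs.1.trans ht.1.le, (ht.2.trans_le (min_le_right _ _)).le⟩⟩

lemma nhdsWithin_Icc_inter_Ioi {s T : ℝ} (hs : s ∈ Ico 0 T) : 𝓝[Icc 0 T ∩ Ioi s] s = 𝓝[>] s := by
  rw [← nhdsWithin_Ioc_eq_nhdsGT hs.2]
  congr 1
  ext t
  exact ⟨fun h => ⟨h.2, h.1.2⟩, fun h => ⟨⟨hs.1.trans h.1.le, h.2⟩, h.1⟩⟩

lemma Data.neg_mem_F_of_control {P : Data n m d} {q : XAB n m} {u u' : E d} {v : E n}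
    (h : -v ∈ P.F q u) : -(v + (P.g q.1 u' - P.g q.1 u)) ∈ P.F q u' := by
  rw [mem_F] at h ⊢
  convert h using 1
  abel

namespace Quad

variable {P : Data n m d} {z : Quad P}

/-- A right limit of the rates is taken along times at which the differential inclusion holds. -/
lemma Feasible.exists_right_rate (hz : z.Feasible) (hU : IsClosed P.U)
    (hg : ContinuousOn (Function.uncurry P.g) (univ ×ˢ P.U)) (hBV : BVQuad z) {s : ℝ}
    (hs : s ∈ Ico 0 P.T) (hslater : Slater (z.a.toFun s) (z.b.toFun s)) :
    ∃ p : XAB n m × E d, Tendsto z.rate (𝓝[>] s) (𝓝 p) ∧ p.2 ∈ P.U ∧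
      -p.1.1 ∈ P.F (z.pos s) p.2 := by
  obtain ⟨p, hp⟩ := hBV.boundedVariationOn_rate.exists_tendsto_right s
  rw [nhdsWithin_Icc_inter_Ioi hs] at hp
  have hpos : Tendsto z.pos (𝓝[>] s) (𝓝 (z.pos s)) := by
    have h := (z.trajectory.continuousOn s (Ico_subset_Icc_self hs)).tendsto.mono_left
      (nhdsWithin_mono s (inter_subset_left (t := Ioi s)))
    rwa [nhdsWithin_Icc_inter_Ioi hs] at h
  let good : Set ℝ := {t | z.u t ∈ P.U ∧ -z.x.vel t ∈ P.F (z.pos t) (z.u t)}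
  have : (𝓝[>] s ⊓ 𝓟 good).NeBot :=
    frequently_iff_neBot.1 (frequently_nhdsGT_of_ae_Icc (hz.control.and hz.inclusion) hs)
  have hgood : ∀ᶠ t in 𝓝[>] s ⊓ 𝓟 good, t ∈ good := mem_inf_of_right (mem_principal_self _)
  have hp' : Tendsto z.rate (𝓝[>] s ⊓ 𝓟 good) (𝓝 p) := hp.mono_left inf_le_left
  have hpU : p.2 ∈ P.U := hU.mem_of_tendsto hp'.snd_nhds (hgood.mono fun t ht => ht.1)
  exact ⟨p, hp, hpU, P.mem_F_of_tendsto hg (hpos.mono_left inf_le_left) hp'.snd_nhds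
    hp'.fst_nhds.fst_nhds.neg hslater hpU (hgood.mono fun t ht => ht.1)
    (hgood.mono fun t ht => ht.2)⟩

lemma norm_sub_rate_le_variation (hBV : BVQuad z) {s t : ℝ} (hs : 0 ≤ s) (hst : s < t)
    (ht : t ≤ P.T) {p : XAB n m × E d} (hp : Tendsto z.rate (𝓝[>] s) (𝓝 p)) {τ : ℝ}
    (hτ : τ ∈ Icc s t) : ‖p - z.rate τ‖ ≤ (eVariationOn z.rate (Icc s t)).toReal := by
  have hBVst := hBV.boundedVariationOn_rate.mono (Icc_subset_Icc hs ht)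
  refine le_of_tendsto (hp.sub_const _).norm ?_
  filter_upwards [Ioo_mem_nhdsGT hst] with σ hσ
  rw [← dist_eq_norm]
  exact hBVst.dist_le (Ioo_subset_Icc_self hσ) hτ

lemma exists_node_rate (hz : z.Feasible) (hU : IsClosed P.U) {L : NNReal}
    (hg : LipschitzOnWith L (Function.uncurry P.g) (univ ×ˢ P.U)) (hBV : BVQuad z)
    (hu0 : z.u 0 ∈ P.U) {s t : ℝ} (hs : 0 ≤ s) (hst : s < t) (ht : t ≤ P.T)
    (hslater : Slater (z.a.toFun s) (z.b.toFun s)) :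
    ∃ v, ∃ u ∈ P.U, (s = 0 → u = z.u 0) ∧ -v ∈ P.F (z.pos s) u ∧ ∀ τ ∈ Icc s t,
      ‖v - z.x.vel τ‖ ≤ (1 + L) * (eVariationOn z.rate (Icc s t)).toReal ∧
        ‖u - z.u τ‖ ≤ (eVariationOn z.rate (Icc s t)).toReal := by
  set ω := (eVariationOn z.rate (Icc s t)).toReal
  obtain ⟨p, hp, hpU, hpF⟩ := hz.exists_right_rate hU hg.continuousOn hBV ⟨hs, hst.trans_le ht⟩
    hslater
  have hpω (τ : ℝ) (hτ : τ ∈ Icc s t) : ‖p - z.rate τ‖ ≤ ω :=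
    norm_sub_rate_le_variation hBV hs hst ht hp hτ
  have hsst : s ∈ Icc s t := left_mem_Icc.2 hst.le
  obtain ⟨u, huU, hinit, huω, hup⟩ : ∃ u ∈ P.U, (s = 0 → u = z.u 0) ∧
      (∀ τ ∈ Icc s t, ‖u - z.u τ‖ ≤ ω) ∧ ‖u - p.2‖ ≤ ω := by
    rcases eq_or_ne s 0 with rfl | hs0
    · refine ⟨z.u 0, hu0, fun _ => rfl, fun τ hτ => ?_, ?_⟩
      · have h := (hBV.boundedVariationOn_rate.mono (Icc_subset_Icc hs ht)).dist_le hsst hτ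
        rw [dist_eq_norm] at h
        exact (norm_snd_le (z.rate 0 - z.rate τ)).trans h
      · rw [norm_sub_rev]
        exact (norm_snd_le (p - z.rate 0)).trans (hpω 0 hsst)
    · refine ⟨p.2, hpU, fun h => absurd h hs0,
        fun τ hτ => (norm_snd_le (p - z.rate τ)).trans (hpω τ hτ), ?_⟩
      simpa using (norm_nonneg _).trans (hpω s hsst)
  refine ⟨_, u, huU, hinit, Data.neg_mem_F_of_control hpF, fun τ hτ => ⟨?_, huω τ hτ⟩⟩
  rw [add_sub_right_comm, one_add_mul]
  refine (norm_add_le _ _).trans (add_le_add ?_ ?_)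
  · exact (norm_fst_le (p - z.rate τ).1).trans ((norm_fst_le (p - z.rate τ)).trans (hpω τ hτ))
  · refine (P.norm_g_sub_g_le hg huU hpU).trans ?_
    rw [sub_self, norm_zero, max_eq_right (norm_nonneg _)]
    gcongr

/-- The oscillation of the rates of `z` over the `j`-th cell. -/
noncomputable def oscillation (z : Quad P) (Δ : Mesh P.T) (j : Fin Δ.ν) : ℝ :=
  (eVariationOn z.rate (Δ.cell j)).toReal

/-- Velocities and controls assigned to the nodes that satisfy the sweeping inclusion along `z`
and approximate the rates of `z` on the cells. -/
structure IsNodeSelection (z : Quad P) (L : NNReal) (Δ : Mesh P.T) (v : Fin Δ.ν → E n)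
    (u : Fin Δ.ν → E d) : Prop where
  control : ∀ j, u j ∈ P.U
  initial : ∀ j : Fin Δ.ν, (j : ℕ) = 0 → u j = z.u 0
  inclusion : ∀ j, -v j ∈ P.F (z.pos (Δ.t j.castSucc)) (u j)
  vel_le : ∀ j, ∀ τ ∈ Δ.cell j, ‖v j - z.x.vel τ‖ ≤ (1 + L) * z.oscillation Δ j
  control_le : ∀ j, ∀ τ ∈ Δ.cell j, ‖u j - z.u τ‖ ≤ z.oscillation Δ j

lemma exists_isNodeSelection (hz : z.Feasible) (hU : IsClosed P.U) {L : NNReal}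
    (hg : LipschitzOnWith L (Function.uncurry P.g) (univ ×ˢ P.U)) (hBV : BVQuad z)
    (hslater : ∀ t ∈ Icc 0 P.T, Slater (z.a.toFun t) (z.b.toFun t)) (hu0 : z.u 0 ∈ P.U)
    (Δ : Mesh P.T) : ∃ v u, z.IsNodeSelection L Δ v u := by
  choose v u huU hinit hF hclose using fun j : Fin Δ.ν => exists_node_rate hz hU hg hBV hu0
    (Δ.t_mem j.castSucc).1 (Δ.strictMono Fin.castSucc_lt_succ) (Δ.t_mem j.succ).2
    (hslater _ (Δ.t_mem j.castSucc))
  refine ⟨v, u, huU, fun j hj => hinit j ?_, hF, fun j τ hτ => (hclose j τ hτ).1,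
    fun j τ hτ => (hclose j τ hτ).2⟩
  rw [show j.castSucc = 0 from Fin.ext hj, Δ.t_zero]

end Quad

/-! ### A feasible discrete trajectory near `z` -/

namespace Mesh

variable {T : ℝ} (Δ : Mesh T) {V : Type}

/-- The Euler polygon of the fields `f j` with initial value `x₀`. -/
def eulerPath [AddCommGroup V] [Module ℝ V] (f : Fin Δ.ν → V → V) (x₀ : V) : Fin (Δ.ν + 1) → V :=
  Fin.induction x₀ fun j x => x + Δ.h j • f j x

variable [NormedAddCommGroup V] [NormedSpace ℝ V] {f : Fin Δ.ν → V → V} {x₀ : V}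

@[simp]
lemma eulerPath_zero : Δ.eulerPath f x₀ 0 = x₀ := rfl

lemma eulerPath_succ (j : Fin Δ.ν) : Δ.eulerPath f x₀ j.succ =
    Δ.eulerPath f x₀ j.castSucc + Δ.h j • f j (Δ.eulerPath f x₀ j.castSucc) := by
  simp [eulerPath]

lemma inv_smul_eulerPath_sub (j : Fin Δ.ν) :
    (Δ.h j)⁻¹ • (Δ.eulerPath f x₀ j.succ - Δ.eulerPath f x₀ j.castSucc) =
      f j (Δ.eulerPath f x₀ j.castSucc) := by
  rw [eulerPath_succ, add_sub_cancel_left, inv_smul_smul₀ (Δ.h_pos j).ne']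

lemma norm_eulerPath_sub_le [CompleteSpace V] (y : W12 T V) {L : NNReal} {c : Fin Δ.ν → ℝ}
    (hf : ∀ j, LipschitzWith L (f j))
    (hc : ∀ j, ∀ τ ∈ Δ.cell j, ‖f j (y.toFun (Δ.t j.castSucc)) - y.vel τ‖ ≤ c j)
    (i : Fin (Δ.ν + 1)) : ‖Δ.eulerPath f (y.toFun 0) i - y.toFun (Δ.t i)‖ ≤
      (∑ j, Δ.h j * c j) * Real.exp (L * T) := by
  set ξ := Δ.eulerPath f (y.toFun 0)
  have hc0 (j : Fin Δ.ν) : 0 ≤ c j :=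
    (norm_nonneg _).trans (hc j _ (left_mem_Icc.2 (Δ.castSucc_le_succ j)))
  have hstep (j : Fin Δ.ν) : ‖ξ j.succ - y.toFun (Δ.t j.succ)‖ ≤
      (1 + L * Δ.h j) * ‖ξ j.castSucc - y.toFun (Δ.t j.castSucc)‖ + Δ.h j * c j := by
    have hh := (Δ.h_pos j).le
    have hincrement : ξ j.succ - y.toFun (Δ.t j.succ) =
        (ξ j.castSucc - y.toFun (Δ.t j.castSucc)) +
          Δ.h j • (f j (ξ j.castSucc) - f j (y.toFun (Δ.t j.castSucc))) +
          ∫ τ in (Δ.t j.castSucc)..(Δ.t j.succ),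
            (f j (y.toFun (Δ.t j.castSucc)) - y.vel τ) := by
      have hξ : ξ j.succ = ξ j.castSucc + Δ.h j • f j (ξ j.castSucc) := Δ.eulerPath_succ j
      rw [y.integral_const_sub_vel (Δ.t_mem _) (Δ.t_mem _), hξ, ← h, smul_sub]
      abel
    have hint : ‖∫ τ in (Δ.t j.castSucc)..(Δ.t j.succ),
        (f j (y.toFun (Δ.t j.castSucc)) - y.vel τ)‖ ≤ c j * Δ.h j := by
      rw [← abs_of_nonneg hh]
      exact intervalIntegral.norm_integral_le_of_norm_le_const fun τ hτ =>
        hc j τ (Ioc_subset_Icc_self (uIoc_of_le (Δ.castSucc_le_succ j) ▸ hτ))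
    rw [hincrement]
    refine norm_add₃_le.trans ?_
    rw [norm_smul, Real.norm_of_nonneg hh]
    have := mul_le_mul_of_nonneg_left
      ((hf j).norm_sub_le (ξ j.castSucc) (y.toFun (Δ.t j.castSucc))) hh
    linarith
  have hgronwall := le_gronwall_fin (r := fun j => ‖ξ j - y.toFun (Δ.t j)‖) (norm_nonneg _)
    (fun j => mul_nonneg L.2 (Δ.h_pos j).le) (fun j => mul_nonneg (Δ.h_pos j).le (hc0 j)) hstep i
  simpa [ξ, Δ.t_zero, ← Finset.mul_sum, Δ.sum_h] using hgronwall

end Mesh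

namespace Quad

variable {P : Data n m d} (z : Quad P) (Δ : Mesh P.T) (v : Fin Δ.ν → E n) (u : Fin Δ.ν → E d)

lemma sum_oscillation {z : Quad P} (hBV : BVQuad z) :
    ∑ j, z.oscillation Δ j = (eVariationOn z.rate (Icc 0 P.T)).toReal :=
  Δ.sum_variation hBV.boundedVariationOn_rate

/-- The velocity field `x ↦ vⱼ + g(x, uⱼ) - g(x̄(tⱼ), uⱼ)`: its normal component is the one of
`vⱼ`, which remains normal when the polyhedron is translated. -/
def shadowField (j : Fin Δ.ν) (x : E n) : E n :=
  v j + (P.g x (u j) - P.g (z.x.toFun (Δ.t j.castSucc)) (u j))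

/-- The discrete trajectory that follows the fields `shadowField`, with the polyhedra of `z`
translated so as to follow it. -/
noncomputable def shadow : DiscreteQuad n m d Δ.ν where
  x := Δ.eulerPath (z.shadowField Δ v u) (z.x.toFun 0)
  a i := z.a.toFun (Δ.t i)
  b i := z.b.toFun (Δ.t i) + pairing (z.a.toFun (Δ.t i))
    (Δ.eulerPath (z.shadowField Δ v u) (z.x.toFun 0) i - z.x.toFun (Δ.t i))
  u := u

/-- The deviation of the shadow trajectory from `x̄` at the nodes. -/
noncomputable def shadowError (i : Fin (Δ.ν + 1)) : E n :=
  (z.shadow Δ v u).x i - z.x.toFun (Δ.t i)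

lemma shadow_pos (i : Fin (Δ.ν + 1)) : (z.shadow Δ v u).pos i = z.pos (Δ.t i) +
    (z.shadowError Δ v u i, 0, pairing (z.a.toFun (Δ.t i)) (z.shadowError Δ v u i)) := by
  simp [DiscreteQuad.pos, pos, shadowError, shadow]

lemma shadow_vel (j : Fin Δ.ν) {s : E n}
    (hs : s = (Δ.h j)⁻¹ • (z.shadowError Δ v u j.succ - z.shadowError Δ v u j.castSucc)) :
    (z.shadow Δ v u).vel Δ j =
      (Δ.h j)⁻¹ • (z.pos (Δ.t j.succ) - z.pos (Δ.t j.castSucc)) +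
        (s, 0, pairing (z.a.toFun (Δ.t j.succ)) s + pairing
          ((Δ.h j)⁻¹ • (z.a.toFun (Δ.t j.succ) - z.a.toFun (Δ.t j.castSucc)))
          (z.shadowError Δ v u j.castSucc)) := by
  have hb : pairing (z.a.toFun (Δ.t j.succ)) s + pairing
        ((Δ.h j)⁻¹ • (z.a.toFun (Δ.t j.succ) - z.a.toFun (Δ.t j.castSucc)))
        (z.shadowError Δ v u j.castSucc) =
      (Δ.h j)⁻¹ • (pairing (z.a.toFun (Δ.t j.succ)) (z.shadowError Δ v u j.succ) -
        pairing (z.a.toFun (Δ.t j.castSucc)) (z.shadowError Δ v u j.castSucc)) := by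
    rw [pairing_sub_pairing, smul_add, hs, smul_pairing, pairing_smul]
  rw [DiscreteQuad.vel, shadow_pos, shadow_pos, add_sub_add_comm, smul_add, hb, hs]
  simp

variable {z Δ v u} {L : NNReal}

namespace IsNodeSelection

variable (h : z.IsNodeSelection L Δ v u)
include h

lemma lipschitzWith_shadowField (hg : LipschitzOnWith L (Function.uncurry P.g) (univ ×ˢ P.U))
    (j : Fin Δ.ν) : LipschitzWith L (z.shadowField Δ v u j) := by
  refine LipschitzWith.of_dist_le_mul fun x x' => ?_
  rw [dist_eq_norm, dist_eq_norm, shadowField, shadowField, add_sub_add_left_eq_sub,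
    sub_sub_sub_cancel_right]
  simpa using P.norm_g_sub_g_le hg (x := x) (x' := x') (h.control j) (h.control j)

lemma norm_shadowError_le (hg : LipschitzOnWith L (Function.uncurry P.g) (univ ×ˢ P.U))
    (hBV : BVQuad z) {η : ℝ} (hη : ∀ j, Δ.h j ≤ η) (i : Fin (Δ.ν + 1)) :
    ‖z.shadowError Δ v u i‖ ≤
      (1 + L) * (eVariationOn z.rate (Icc 0 P.T)).toReal * Real.exp (L * P.T) * η := by
  have hfield (j : Fin Δ.ν) (τ : ℝ) (hτ : τ ∈ Δ.cell j) :
      ‖z.shadowField Δ v u j (z.x.toFun (Δ.t j.castSucc)) - z.x.vel τ‖ ≤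
        (1 + L) * z.oscillation Δ j := by
    rw [shadowField, sub_self, add_zero]
    exact h.vel_le j τ hτ
  have hω (j : Fin Δ.ν) : 0 ≤ z.oscillation Δ j := ENNReal.toReal_nonneg
  calc _ ≤ (∑ j, Δ.h j * ((1 + L) * z.oscillation Δ j)) * Real.exp (L * P.T) :=
        Δ.norm_eulerPath_sub_le z.x (h.lipschitzWith_shadowField hg) hfield i
    _ ≤ (∑ j, η * ((1 + L) * z.oscillation Δ j)) * Real.exp (L * P.T) := by
        gcongr with j
        · have := hω j; positivity
        · exact hη j
    _ = _ := by
        rw [← Finset.mul_sum, ← Finset.mul_sum, sum_oscillation Δ hBV]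
        ring

lemma norm_slope_shadowError_le (hg : LipschitzOnWith L (Function.uncurry P.g) (univ ×ˢ P.U))
    (j : Fin Δ.ν) :
    ‖(Δ.h j)⁻¹ • (z.shadowError Δ v u j.succ - z.shadowError Δ v u j.castSucc)‖ ≤
      L * ‖z.shadowError Δ v u j.castSucc‖ + (1 + L) * z.oscillation Δ j := by
  set ξ := (z.shadow Δ v u).x
  have hslope : (Δ.h j)⁻¹ • (ξ j.succ - ξ j.castSucc) = z.shadowField Δ v u j (ξ j.castSucc) :=
    Δ.inv_smul_eulerPath_sub j
  rw [shadowError, shadowError, sub_sub_sub_comm, smul_sub, hslope, norm_sub_rev]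
  refine z.x.norm_slope_sub_le (Δ.t_mem _) (Δ.t_mem _) (Δ.strictMono Fin.castSucc_lt_succ)
    fun τ hτ => ?_
  have hsplit : z.shadowField Δ v u j (ξ j.castSucc) - z.x.vel τ =
      (z.shadowField Δ v u j (ξ j.castSucc) -
        z.shadowField Δ v u j (z.x.toFun (Δ.t j.castSucc))) + (v j - z.x.vel τ) := by
    rw [shadowField, shadowField]
    abel
  rw [hsplit]
  exact (norm_add_le _ _).trans (add_le_add
    ((h.lipschitzWith_shadowField hg j).norm_sub_le _ _) (h.vel_le j τ hτ))

end IsNodeSelection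

end Quad

namespace Quad

variable {P : Data n m d} {z : Quad P}

lemma norm_rate_sub_le_oscillation (hBV : BVQuad z) {Δ : Mesh P.T} {j : Fin Δ.ν} {s t : ℝ}
    (hs : s ∈ Δ.cell j) (ht : t ∈ Δ.cell j) : ‖z.rate s - z.rate t‖ ≤ z.oscillation Δ j := by
  rw [← dist_eq_norm]
  exact (hBV.boundedVariationOn_rate.mono (Δ.cell_subset j)).dist_le hs ht

lemma exists_norm_vel_le (hBV : BVQuad z) : ∃ B, 0 ≤ B ∧ ∀ t ∈ Icc 0 P.T, ‖z.vel t‖ ≤ B := by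
  refine ⟨(eVariationOn z.rate (Icc 0 P.T)).toReal + ‖z.rate 0‖, by positivity, fun t ht => ?_⟩
  have h := hBV.boundedVariationOn_rate.dist_le ht (left_mem_Icc.2 P.T_pos.le)
  rw [dist_eq_norm] at h
  exact (norm_fst_le (z.rate t)).trans (norm_le_norm_sub_add _ _ |>.trans (by gcongr))

variable {Δ : Mesh P.T} {v : Fin Δ.ν → E n} {u : Fin Δ.ν → E d} {α β : ℝ}

lemma norm_shadow_pos_sub_le (hα : 1 ≤ α) (ha : ∀ t ∈ Icc 0 P.T, ‖z.a.toFun t‖ ≤ α)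
    (hβ : ∀ t ∈ Icc 0 P.T, ‖z.vel t‖ ≤ β) {j : Fin Δ.ν} {τ : ℝ} (hτ : τ ∈ Δ.cell j) :
    ‖(z.shadow Δ v u).pos j.castSucc - z.pos τ‖ ≤
      α * ‖z.shadowError Δ v u j.castSucc‖ + β * Δ.h j := by
  set e := z.shadowError Δ v u j.castSucc
  have hj := Δ.t_mem j.castSucc
  have hpair : ‖pairing (z.a.toFun (Δ.t j.castSucc)) e‖ ≤ α * ‖e‖ :=
    (norm_pairing_le _ _).trans (mul_le_mul_of_nonneg_right (ha _ hj) (norm_nonneg _))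
  have hshift : ‖(e, (0 : A n m), pairing (z.a.toFun (Δ.t j.castSucc)) e)‖ ≤ α * ‖e‖ := by
    simp only [norm_prod_le_iff, norm_zero]
    exact ⟨le_mul_of_one_le_left (norm_nonneg _) hα, by positivity, hpair⟩
  have hmove : ‖z.pos (Δ.t j.castSucc) - z.pos τ‖ ≤ β * Δ.h j := by
    refine (z.trajectory.norm_sub_le_mul hβ (Δ.cell_subset j hτ) hj).trans ?_
    have hβ0 : 0 ≤ β := (norm_nonneg _).trans (hβ _ hj)
    gcongr
    rw [abs_sub_comm, abs_of_nonneg (sub_nonneg.2 hτ.1)]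
    exact sub_le_sub_right hτ.2 _
  rw [shadow_pos, add_sub_right_comm, add_comm]
  exact (norm_add_le _ _).trans (add_le_add hshift hmove)

lemma norm_shadow_vel_sub_le (hBV : BVQuad z) (hα : 1 ≤ α)
    (ha : ∀ t ∈ Icc 0 P.T, ‖z.a.toFun t‖ ≤ α) (hβ : ∀ t ∈ Icc 0 P.T, ‖z.vel t‖ ≤ β)
    {j : Fin Δ.ν} {τ : ℝ} (hτ : τ ∈ Δ.cell j) :
    ‖(z.shadow Δ v u).vel Δ j - z.vel τ‖ ≤ z.oscillation Δ j + (α * ‖(Δ.h j)⁻¹ •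
        (z.shadowError Δ v u j.succ - z.shadowError Δ v u j.castSucc)‖ +
      β * ‖z.shadowError Δ v u j.castSucc‖) := by
  set s := (Δ.h j)⁻¹ • (z.shadowError Δ v u j.succ - z.shadowError Δ v u j.castSucc)
  set e := z.shadowError Δ v u j.castSucc
  have hβ0 : 0 ≤ β := (norm_nonneg _).trans (hβ _ (Δ.cell_subset j hτ))
  have hslope : ‖(Δ.h j)⁻¹ • (z.pos (Δ.t j.succ) - z.pos (Δ.t j.castSucc)) - z.vel τ‖ ≤
      z.oscillation Δ j :=
    z.trajectory.norm_slope_sub_le (Δ.t_mem _) (Δ.t_mem _) (Δ.strictMono Fin.castSucc_lt_succ)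
      fun σ hσ => (norm_fst_le (z.rate τ - z.rate σ)).trans (norm_rate_sub_le_oscillation hBV hτ hσ)
  have ha' : ‖(Δ.h j)⁻¹ • (z.a.toFun (Δ.t j.succ) - z.a.toFun (Δ.t j.castSucc))‖ ≤ β := by
    have h := z.a.norm_sub_le_mul (fun τ hτ => (norm_fst_le (z.vel τ).2).trans
      ((norm_snd_le (z.vel τ)).trans (hβ τ hτ))) (Δ.t_mem j.castSucc) (Δ.t_mem j.succ)
    rw [norm_smul, norm_inv, Real.norm_of_nonneg (Δ.h_pos j).le, inv_mul_le_iff₀ (Δ.h_pos j),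
      mul_comm]
    rwa [← Mesh.h, abs_of_pos (Δ.h_pos j)] at h
  rw [shadow_vel z Δ v u j rfl, add_sub_right_comm]
  refine (norm_add_le _ _).trans (add_le_add hslope ?_)
  have hs : ‖s‖ ≤ α * ‖s‖ := le_mul_of_one_le_left (norm_nonneg _) hα
  simp only [norm_prod_le_iff, norm_zero]
  refine ⟨hs.trans (le_add_of_nonneg_right (by positivity)), by positivity, ?_⟩
  refine (norm_add_le _ _).trans (add_le_add ((norm_pairing_le _ _).trans ?_)
    ((norm_pairing_le _ _).trans (by gcongr)))
  gcongr
  exact ha _ (Δ.t_mem _)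

lemma exists_norm_shadow_sub_le {L : NNReal}
    (hg : LipschitzOnWith L (Function.uncurry P.g) (univ ×ˢ P.U)) (hBV : BVQuad z) :
    ∃ C, ∀ (Δ : Mesh P.T) (v : Fin Δ.ν → E n) (u : Fin Δ.ν → E d) (η : ℝ),
      z.IsNodeSelection L Δ v u → (∀ j, Δ.h j ≤ η) → ∀ j, ∀ τ ∈ Δ.cell j,
        ‖((z.shadow Δ v u).pos j.castSucc, u j) - (z.pos τ, z.u τ)‖ ≤
            C * (η + z.oscillation Δ j) ∧
          ‖(z.shadow Δ v u).vel Δ j - z.vel τ‖ ≤ C * (η + z.oscillation Δ j) := by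
  obtain ⟨α, hα, ha⟩ : ∃ α, 1 ≤ α ∧ ∀ t ∈ Icc 0 P.T, ‖z.a.toFun t‖ ≤ α := by
    obtain ⟨α, ha⟩ := isCompact_Icc.exists_bound_of_continuousOn z.a.continuousOn
    exact ⟨max 1 α, le_max_left _ _, fun t ht => (ha t ht).trans (le_max_right _ _)⟩
  obtain ⟨β, hβ0, hβ⟩ := exists_norm_vel_le hBV
  set κ := (1 + L) * (eVariationOn z.rate (Icc 0 P.T)).toReal * Real.exp (L * P.T)
  set C₁ := α * κ + β
  set C₂ := α * (L * κ) + β * κ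
  set C₃ := 1 + α * (1 + L)
  refine ⟨max C₁ (max C₂ C₃), fun Δ v u η h hη j τ hτ => ?_⟩
  set C := max C₁ (max C₂ C₃)
  have hC₁ : C₁ ≤ C := le_max_left _ _
  have hC₂ : C₂ ≤ C := (le_max_left _ _).trans (le_max_right _ _)
  have hC₃ : C₃ ≤ C := (le_max_right _ _).trans (le_max_right _ _)
  set ω := z.oscillation Δ j
  have hω : 0 ≤ ω := ENNReal.toReal_nonneg
  have hη0 : 0 ≤ η := (Δ.h_pos j).le.trans (hη j)
  have he := h.norm_shadowError_le hg hBV hη j.castSucc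
  have hs := h.norm_slope_shadowError_le hg j
  refine ⟨norm_prod_le_iff.2 ⟨?_, ?_⟩, ?_⟩
  · calc _ ≤ _ := norm_shadow_pos_sub_le hα ha hβ hτ
      _ ≤ α * (κ * η) + β * η := by gcongr; exact hη j
      _ = C₁ * η := by ring
      _ ≤ C * (η + ω) := by gcongr; exact le_add_of_nonneg_right hω
  · have hC : 1 ≤ C := le_trans (le_add_of_nonneg_right (by positivity)) hC₃
    calc _ ≤ 1 * (0 + ω) := by simpa using h.control_le j τ hτ
      _ ≤ C * (η + ω) := by gcongr
  · calc _ ≤ _ := norm_shadow_vel_sub_le hBV hα ha hβ hτ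
      _ ≤ ω + (α * (L * (κ * η) + (1 + L) * ω) + β * (κ * η)) := by
          gcongr
          exact hs.trans (by gcongr)
      _ = C₂ * η + C₃ * ω := by ring
      _ ≤ C * η + C * ω := by gcongr
      _ = C * (η + ω) := by ring

end Quad

lemma dynamics_iff_neg_vel_mem_F {P : Data n m d} {Δ : Mesh P.T} {w : DiscreteQuad n m d Δ.ν}
    {j : Fin Δ.ν} :
    (∃ v ∈ P.F (w.pos j.castSucc) (w.u j), w.x j.succ = w.x j.castSucc - Δ.h j • v) ↔
      -(w.vel Δ j).1 ∈ P.F (w.pos j.castSucc) (w.u j) := by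
  have hvel : (w.vel Δ j).1 = (Δ.h j)⁻¹ • (w.x j.succ - w.x j.castSucc) := rfl
  have hh := (Δ.h_pos j).ne'
  constructor
  · rintro ⟨v, hv, hstep⟩
    rwa [hvel, hstep, sub_sub_cancel_left, smul_neg, neg_neg, inv_smul_smul₀ hh]
  · refine fun h => ⟨_, h, ?_⟩
    rw [hvel, smul_neg, smul_inv_smul₀ hh]
    abel

namespace Quad

variable {P : Data n m d} {z : Quad P} {Δ : Mesh P.T} {v : Fin Δ.ν → E n} {u : Fin Δ.ν → E d}
  {L : NNReal}

lemma IsNodeSelection.neg_vel_shadow_mem (h : z.IsNodeSelection L Δ v u) (j : Fin Δ.ν) :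
    -((z.shadow Δ v u).vel Δ j).1 ∈ P.F ((z.shadow Δ v u).pos j.castSucc) (u j) := by
  set e := z.shadowError Δ v u j.castSucc
  have hvel : ((z.shadow Δ v u).vel Δ j).1 =
      z.shadowField Δ v u j ((z.shadow Δ v u).x j.castSucc) :=
    Δ.inv_smul_eulerPath_sub j
  have hx : (z.shadow Δ v u).x j.castSucc = z.x.toFun (Δ.t j.castSucc) + e :=
    (add_sub_cancel _ _).symm
  have hfield : -z.shadowField Δ v u j ((z.shadow Δ v u).x j.castSucc) +
      P.g ((z.shadow Δ v u).x j.castSucc) (u j) =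
      -v j + P.g (z.x.toFun (Δ.t j.castSucc)) (u j) := by
    rw [shadowField]
    abel
  rw [Data.mem_F, hvel, DiscreteQuad.pos, hfield, hx]
  exact mem_normalCone_add_pairing (Data.mem_F.1 (h.inclusion j))

lemma IsNodeSelection.discreteFeasible_shadow (hz : z.Feasible) (h : z.IsNodeSelection L Δ v u)
    {ε δ : ℝ} (hδ : 0 ≤ δ)
    (hclose : ∑ j, ∫ t in (Δ.t j.castSucc)..(Δ.t j.succ),
      energy (((z.shadow Δ v u).pos j.castSucc, u j) - (z.pos t, z.u t)) ≤ ε / 2)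
    (hvel : ∑ j, ∫ t in (Δ.t j.castSucc)..(Δ.t j.succ),
      sqNorm ((z.shadow Δ v u).vel Δ j - z.vel t) ≤ ε / 2) :
    DiscreteFeasible z ε δ Δ (z.shadow Δ v u) where
  dynamics j := dynamics_iff_neg_vel_mem_F.2 (h.neg_vel_shadow_mem j)
  terminal := by
    refine mem_polyhedron_add_pairing.2 ?_
    have := hz.mixed _ (Δ.t_mem (Fin.last Δ.ν))
    simpa [shadow] using this
  initial_x := hz.initial.1
  initial_mem := by
    have := hz.mixed 0 (left_mem_Icc.2 P.T_pos.le)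
    rwa [hz.initial.1, hz.initial.2.1, hz.initial.2.2] at this
  initial_a := by simpa [shadow, Δ.t_zero] using hz.initial.2.1
  initial_b := by
    have hpair : pairing (z.a.toFun 0) 0 = 0 := by ext; simp [pairing_apply]
    simpa [shadow, Δ.t_zero, hpair] using hz.initial.2.2
  initial_u := h.initial
  close := hclose
  close_vel := hvel
  control := h.control
  norm_a j i := by
    have := hz.unit _ (Δ.t_mem j) i
    simp only [shadow, this]
    constructor <;> linarith

lemma exists_discreteFeasible (hz : z.Feasible) (hU : IsClosed P.U)
    (hg : LipschitzOnWith L (Function.uncurry P.g) (univ ×ˢ P.U)) (hBV : BVQuad z)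
    (hslater : ∀ t ∈ Icc 0 P.T, Slater (z.a.toFun t) (z.b.toFun t)) (hu0 : z.u 0 ∈ P.U)
    {ε : ℝ} (hε : 0 < ε) :
    ∃ η > 0, ∀ Δ : Mesh P.T, (∀ j, Δ.h j ≤ η) → ∀ δ, 0 ≤ δ →
      ∃ w, DiscreteFeasible z ε δ Δ w := by
  obtain ⟨C, hdev⟩ := exists_norm_shadow_sub_le hg hBV
  set V := (eVariationOn z.rate (Icc 0 P.T)).toReal
  set K := 2 * (4 * C ^ 2) * (P.T + V ^ 2)
  have hK : 0 ≤ K := by have := P.T_pos; positivity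
  obtain ⟨η, hη, hη1, hηε⟩ : ∃ η > 0, η ≤ 1 ∧ K * η ≤ ε / 2 := by
    refine ⟨min 1 (ε / 2 / (K + 1)), by positivity, min_le_left _ _, ?_⟩
    calc _ ≤ (K + 1) * (ε / 2 / (K + 1)) := by
          gcongr
          · linarith
          · exact min_le_right _ _
      _ = ε / 2 := mul_div_cancel₀ _ (by positivity)
  refine ⟨η, hη, fun Δ hΔ δ hδ => ?_⟩
  obtain ⟨v, u, h⟩ := exists_isNodeSelection hz hU hg hBV hslater hu0 Δ
  have hsum {F : Fin Δ.ν → ℝ → ℝ} (hF : ∀ j, ∀ τ ∈ Δ.cell j,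
      ‖F j τ‖ ≤ 4 * (C * (η + z.oscillation Δ j)) ^ 2) :
      ∑ j, ∫ τ in (Δ.t j.castSucc)..(Δ.t j.succ), F j τ ≤ ε / 2 := by
    have h := Δ.sum_integral_le hη.le hη1 (by positivity : 0 ≤ 4 * C ^ 2)
      (ω := z.oscillation Δ) (fun j => ENNReal.toReal_nonneg) hΔ
      fun j τ hτ => (hF j τ hτ).trans_eq (by ring)
    rw [sum_oscillation Δ hBV] at h
    exact h.trans hηε
  refine ⟨_, h.discreteFeasible_shadow hz hδ (hsum fun j τ hτ => ?_) (hsum fun j τ hτ => ?_)⟩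
  · refine (norm_energy_le _).trans ?_
    gcongr
    exact (hdev Δ v u η h hΔ j τ hτ).1
  · refine (norm_sqNorm_le _).trans ?_
    gcongr
    · norm_num
    · exact (hdev Δ v u η h hΔ j τ hτ).2

end Quad

/-! ### Compactness of the feasible set -/

/-- The discrete quadruple with the given positions and controls; it transports the topology of
the product to discrete quadruples. -/
def DiscreteQuad.ofProd {ν : ℕ} (p : (Fin (ν + 1) → XAB n m) × (Fin ν → E d)) :
    DiscreteQuad n m d ν :=
  ⟨fun j => (p.1 j).1, fun j => (p.1 j).2.1, fun j => (p.1 j).2.2, p.2⟩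

/-- The set of feasible points of the discrete problem, as a subset of the product of the spaces
of positions and of controls. -/
def discreteFeasibleSet {P : Data n m d} (z : Quad P) (ε δ : ℝ) (Δ : Mesh P.T) :
    Set ((Fin (Δ.ν + 1) → XAB n m) × (Fin Δ.ν → E d)) :=
  {p | DiscreteFeasible z ε δ Δ (DiscreteQuad.ofProd p)}

namespace DiscreteQuad

lemma continuous_pos_ofProd {ν : ℕ} (j : Fin (ν + 1)) :
    Continuous fun p : (Fin (ν + 1) → XAB n m) × (Fin ν → E d) => (ofProd p).pos j :=
  (continuous_apply j).comp continuous_fst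

lemma continuous_u_ofProd {ν : ℕ} (j : Fin ν) :
    Continuous fun p : (Fin (ν + 1) → XAB n m) × (Fin ν → E d) => (ofProd p).u j :=
  (continuous_apply j).comp continuous_snd

lemma continuous_vel_ofProd {T : ℝ} (Δ : Mesh T) (j : Fin Δ.ν) :
    Continuous fun p : (Fin (Δ.ν + 1) → XAB n m) × (Fin Δ.ν → E d) => (ofProd p).vel Δ j :=
  ((continuous_pos_ofProd j.succ).sub (continuous_pos_ofProd j.castSucc)).const_smul (Δ.h j)⁻¹

lemma continuous_norm_a_ofProd {ν : ℕ} (j : Fin (ν + 1)) (i : Fin m) :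
    Continuous fun p : (Fin (ν + 1) → XAB n m) × (Fin ν → E d) => ‖(ofProd p).a j i‖ :=
  ((PiLp.continuous_apply 2 _ i).comp (continuous_pos_ofProd j).snd.fst).norm

end DiscreteQuad

section

variable {P : Data n m d} {z : Quad P} {ε δ r : ℝ} {Δ : Mesh P.T}

lemma Quad.pos_zero (hz : z.Initial) : z.pos 0 = (P.x₀, P.a₀, P.b₀) := by
  rw [Quad.pos, hz.1, hz.2.1, hz.2.2]

lemma DiscreteFeasible.pos_zero {w : DiscreteQuad n m d Δ.ν} (hw : DiscreteFeasible z ε δ Δ w) :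
    w.pos 0 = (P.x₀, P.a₀, P.b₀) := by
  rw [DiscreteQuad.pos, hw.initial_x, hw.initial_a, hw.initial_b]

lemma DiscreteQuad.norm_pos_sub_lt {w : DiscreteQuad n m d Δ.ν} (hr : 0 < r)
    (hε : ε ≤ r ^ 2 / P.T) (hinit : w.pos 0 = z.pos 0)
    (hclose : ∑ j : Fin Δ.ν, ∫ t in (Δ.t j.castSucc)..(Δ.t j.succ),
      sqNorm (w.vel Δ j - z.vel t) ≤ ε / 2) (j : Fin (Δ.ν + 1)) :
    ‖w.pos j - z.pos (Δ.t j)‖ < r := by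
  refine z.trajectory.norm_sub_lt_of_sum_integral_le P.T_pos hr hε Δ hinit
    (le_trans (Finset.sum_le_sum fun i _ => ?_) hclose) j
  have hmem := memLp_restrict_uIoc z.trajectory.memLp_vel (Δ.t_mem i.castSucc) (Δ.t_mem i.succ)
  exact intervalIntegral.integral_mono_on (Δ.castSucc_le_succ i)
    (intervalIntegrable_norm_sub_sq hmem _)
    (intervalIntegrable_comp_sub_of_le_sq continuous_sqNorm norm_sqNorm_le hmem _)
    fun τ _ => norm_sq_le_sqNorm _

lemma DiscreteFeasible.norm_pos_sub_lt {w : DiscreteQuad n m d Δ.ν}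
    (hw : DiscreteFeasible z ε δ Δ w) (hz : z.Initial) (hr : 0 < r) (hε : ε ≤ r ^ 2 / P.T)
    (j : Fin (Δ.ν + 1)) : ‖w.pos j - z.pos (Δ.t j)‖ < r :=
  DiscreteQuad.norm_pos_sub_lt hr hε (hw.pos_zero.trans (z.pos_zero hz).symm) hw.close_vel j

lemma DiscreteFeasible.integral_norm_control_sub_sq_le {w : DiscreteQuad n m d Δ.ν}
    (hw : DiscreteFeasible z ε δ Δ w) (j : Fin Δ.ν) :
    ∫ t in (Δ.t j.castSucc)..(Δ.t j.succ), ‖w.u j - z.u t‖ ^ 2 ≤ ε / 2 := by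
  have hle (q : XAB n m × E d) : ‖q.2‖ ^ 2 ≤ energy q :=
    le_add_of_nonneg_left ((sq_nonneg _).trans (norm_sq_le_sqNorm q.1))
  have hcell (i : Fin Δ.ν) : ∫ t in (Δ.t i.castSucc)..(Δ.t i.succ), ‖w.u i - z.u t‖ ^ 2 ≤
      ∫ t in (Δ.t i.castSucc)..(Δ.t i.succ),
        energy ((w.pos i.castSucc, w.u i) - (z.pos t, z.u t)) := by
    have hu := memLp_restrict_uIoc z.memLp_u (Δ.t_mem i.castSucc) (Δ.t_mem i.succ)
    have henergy := intervalIntegrable_comp_sub_of_le_sq continuous_energy norm_energy_le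
      (memLp_restrict_uIoc z.memLp_pos_u (Δ.t_mem i.castSucc) (Δ.t_mem i.succ))
      (w.pos i.castSucc, w.u i)
    exact intervalIntegral.integral_mono_on (Δ.castSucc_le_succ i)
      (intervalIntegrable_norm_sub_sq hu (w.u i)) henergy
      fun τ _ => hle ((w.pos i.castSucc, w.u i) - (z.pos τ, z.u τ))
  have hnonneg (i : Fin Δ.ν) : 0 ≤ ∫ t in (Δ.t i.castSucc)..(Δ.t i.succ), ‖w.u i - z.u t‖ ^ 2 :=
    intervalIntegral.integral_nonneg (Δ.castSucc_le_succ i) fun _ _ => sq_nonneg _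
  calc _ ≤ ∑ i, ∫ t in (Δ.t i.castSucc)..(Δ.t i.succ), ‖w.u i - z.u t‖ ^ 2 :=
        Finset.single_le_sum (fun i _ => hnonneg i) (Finset.mem_univ j)
    _ ≤ _ := Finset.sum_le_sum fun i _ => hcell i
    _ ≤ ε / 2 := hw.close

lemma isBounded_discreteFeasibleSet (hz : z.Initial) (hr : 0 < r) (hε : ε ≤ r ^ 2 / P.T) :
    Bornology.IsBounded (discreteFeasibleSet z ε δ Δ) := by
  have hpos : Bornology.IsBounded (univ.pi fun j => Metric.ball (z.pos (Δ.t j)) r) :=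
    .pi fun j => Metric.isBounded_ball
  have hcontrol : Bornology.IsBounded
      (univ.pi fun j : Fin Δ.ν => {v |
        ∫ t in (Δ.t j.castSucc)..(Δ.t j.succ), ‖v - z.u t‖ ^ 2 ≤ ε / 2}) :=
    .pi fun j => isBounded_setOf_integral_norm_sub_sq_le (Δ.strictMono Fin.castSucc_lt_succ)
      (memLp_restrict_uIoc z.memLp_u (Δ.t_mem _) (Δ.t_mem _)) _
  refine (hpos.prod hcontrol).subset fun p hp => ⟨fun j _ => ?_, fun j _ => ?_⟩
  · exact mem_ball_iff_norm.2 (hp.norm_pos_sub_lt hz hr hε j)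
  · exact hp.integral_norm_control_sub_sq_le j

lemma isClosed_discreteFeasibleSet (hz : z.Initial) (hr : 0 < r) (hε : ε ≤ r ^ 2 / P.T)
    (hU : IsClosed P.U) (hg : ContinuousOn (Function.uncurry P.g) (univ ×ˢ P.U))
    (hslater : ∀ t ∈ Icc 0 P.T, ∀ q, ‖q - z.pos t‖ < r → Slater q.2.1 q.2.2) :
    IsClosed (discreteFeasibleSet z ε δ Δ) := by
  refine IsSeqClosed.isClosed fun p p' hp hlim => ?_
  have hp' {s : Set ((Fin (Δ.ν + 1) → XAB n m) × (Fin Δ.ν → E d))} (hs : IsClosed s)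
      (hps : discreteFeasibleSet z ε δ Δ ⊆ s) : p' ∈ s :=
    hs.mem_of_tendsto hlim (Eventually.of_forall fun k => hps (hp k))
  have hpos (j : Fin (Δ.ν + 1)) := DiscreteQuad.continuous_pos_ofProd (n := n) (m := m) (d := d) j
  have hu (j : Fin Δ.ν) := DiscreteQuad.continuous_u_ofProd (n := n) (m := m) (d := d) j
  have hvel (j : Fin Δ.ν) := DiscreteQuad.continuous_vel_ofProd (n := n) (m := m) (d := d) Δ j
  have hinit : (DiscreteQuad.ofProd p').pos 0 = (P.x₀, P.a₀, P.b₀) :=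
    hp' (isClosed_eq (hpos 0) continuous_const) fun q hq => DiscreteFeasible.pos_zero hq
  have hcontrol (j : Fin Δ.ν) : (DiscreteQuad.ofProd p').u j ∈ P.U :=
    hp' (hU.preimage (hu j)) fun q hq => hq.control j
  have hvel_le := hp' (isClosed_le (Δ.continuous_sum_integral_comp_sub_of_le_sq continuous_sqNorm
    norm_sqNorm_le z.trajectory.memLp_vel hvel) continuous_const) fun q hq => hq.close_vel
  have hnear := DiscreteQuad.norm_pos_sub_lt hr hε (hinit.trans (z.pos_zero hz).symm) hvel_le
  exact {
    dynamics := fun j => dynamics_iff_neg_vel_mem_F.2 <| P.mem_F_of_tendsto hg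
      (((hpos j.castSucc).tendsto p').comp hlim) (((hu j).tendsto p').comp hlim)
      (((hvel j).tendsto p').comp hlim).fst_nhds.neg (hslater _ (Δ.t_mem _) _ (hnear _))
      (hcontrol j) (Eventually.of_forall fun k => (hp k).control j)
      (Eventually.of_forall fun k => dynamics_iff_neg_vel_mem_F.1 ((hp k).dynamics j))
    terminal := hp' (isClosed_setOf_mem_polyhedron.preimage (hpos (Fin.last Δ.ν)))
      fun q hq => hq.terminal
    initial_x := congrArg Prod.fst hinit
    initial_mem := (hp 0).initial_mem
    initial_a := congrArg (fun q => q.2.1) hinit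
    initial_b := congrArg (fun q => q.2.2) hinit
    initial_u := fun j hj => hp' (isClosed_eq (hu j) continuous_const) fun q hq => hq.initial_u j hj
    close := hp' (isClosed_le (Δ.continuous_sum_integral_comp_sub_of_le_sq continuous_energy
      norm_energy_le z.memLp_pos_u fun j => (hpos j.castSucc).prodMk (hu j)) continuous_const)
      fun q hq => hq.close
    close_vel := hvel_le
    control := hcontrol
    norm_a := fun j i =>
      have ha := DiscreteQuad.continuous_norm_a_ofProd (n := n) (d := d) j i
      hp' ((isClosed_le continuous_const ha).inter (isClosed_le ha continuous_const))
        fun q hq => hq.norm_a j i }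

lemma isCompact_discreteFeasibleSet (hz : z.Initial) (hr : 0 < r) (hε : ε ≤ r ^ 2 / P.T)
    (hU : IsClosed P.U) (hg : ContinuousOn (Function.uncurry P.g) (univ ×ˢ P.U))
    (hslater : ∀ t ∈ Icc 0 P.T, ∀ q, ‖q - z.pos t‖ < r → Slater q.2.1 q.2.2) :
    IsCompact (discreteFeasibleSet z ε δ Δ) :=
  Metric.isCompact_of_isClosed_isBounded (isClosed_discreteFeasibleSet hz hr hε hU hg hslater)
    (isBounded_discreteFeasibleSet hz hr hε)

end

/-! ### Lower semicontinuity of the cost -/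

section EReal

variable {X ι : Type*} [TopologicalSpace X] {s : Set X}

lemma lowerSemicontinuousOn_ereal_add {f g : X → EReal} (hf : LowerSemicontinuousOn f s)
    (hg : LowerSemicontinuousOn g s) : LowerSemicontinuousOn (fun x => f x + g x) s := by
  intro x hx y hy
  obtain ⟨a, ha, b, hb, hab⟩ : ∃ a < f x, ∃ b < g x, y < a + b := by
    by_contra! h
    exact hy.not_ge (EReal.add_le_of_forall_lt h)
  filter_upwards [hf x hx a ha, hg x hx b hb] with x' ha' hb'
  exact hab.trans_le (add_le_add ha'.le hb'.le)

lemma lowerSemicontinuousOn_ereal_sum {f : ι → X → EReal} (t : Finset ι)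
    (hf : ∀ i ∈ t, LowerSemicontinuousOn (f i) s) :
    LowerSemicontinuousOn (fun x => ∑ i ∈ t, f i x) s := by
  simp only [← Finset.sum_apply]
  exact Finset.sum_induction f (LowerSemicontinuousOn · s)
    (fun _ _ => lowerSemicontinuousOn_ereal_add) lowerSemicontinuousOn_const hf

lemma lowerSemicontinuousOn_coe_mul {c : ℝ} (hc : 0 < c) {f : X → EReal}
    (hf : LowerSemicontinuousOn f s) : LowerSemicontinuousOn (fun x => (c : EReal) * f x) s := by
  have hc' : (0 : EReal) < c := EReal.coe_pos.2 hc
  intro x hx y (hy : y < c * f x)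
  rw [mul_comm, ← EReal.div_lt_iff hc' (EReal.coe_ne_top c)] at hy
  filter_upwards [hf x hx _ hy] with x' hx'
  change y < c * f x'
  rwa [mul_comm, ← EReal.div_lt_iff hc' (EReal.coe_ne_top c)]

end EReal

variable {P : Data n m d} {z : Quad P} {ε δ r ρ : ℝ} {Δ : Mesh P.T}

lemma DiscreteFeasible.mem_tube {w : DiscreteQuad n m d Δ.ν} (hw : DiscreteFeasible z ε δ Δ w)
    (hz : z.Initial) (hρ : 0 < ρ) (hε : ε ≤ ρ ^ 2 / P.T) (j : Fin Δ.ν) :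
    (w.pos j.castSucc, w.u j, w.vel Δ j) ∈ tube z ρ (Δ.t j.castSucc) :=
  ⟨(dist_eq_norm _ _).trans_lt (hw.norm_pos_sub_lt hz hρ hε _), hw.control j⟩

lemma lowerSemicontinuousOn_discreteJ (hz : z.Initial) (hρ : 0 < ρ) (hε : ε ≤ ρ ^ 2 / P.T)
    (hφ : LowerSemicontinuous P.φ)
    (hℓ : ∀ j : Fin Δ.ν, LowerSemicontinuousOn (P.ℓ (Δ.t j.castSucc))
      (tube z ρ (Δ.t j.castSucc))) :
    LowerSemicontinuousOn (fun p => discreteJ z Δ (DiscreteQuad.ofProd p))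
      (discreteFeasibleSet z ε δ Δ) := by
  have hpos (j : Fin (Δ.ν + 1)) := DiscreteQuad.continuous_pos_ofProd (n := n) (m := m) (d := d) j
  have hu (j : Fin Δ.ν) := DiscreteQuad.continuous_u_ofProd (n := n) (m := m) (d := d) j
  have hvel (j : Fin Δ.ν) := DiscreteQuad.continuous_vel_ofProd (n := n) (m := m) (d := d) Δ j
  have hterminal : LowerSemicontinuousOn
      (fun p => P.φ ((DiscreteQuad.ofProd p).x (Fin.last Δ.ν))) (discreteFeasibleSet z ε δ Δ) :=
    (hφ.comp (hpos (Fin.last Δ.ν)).fst).lowerSemicontinuousOn _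
  have hrunning (j : Fin Δ.ν) : LowerSemicontinuousOn
      (fun p => P.ℓ (Δ.t j.castSucc) ((DiscreteQuad.ofProd p).pos j.castSucc,
        (DiscreteQuad.ofProd p).u j, (DiscreteQuad.ofProd p).vel Δ j))
      (discreteFeasibleSet z ε δ Δ) :=
    (hℓ j).comp ((hpos j.castSucc).prodMk ((hu j).prodMk (hvel j))).continuousOn
      fun p hp => hp.mem_tube hz hρ hε j
  have hpenalty := continuous_const (y := (1 / 2 : ℝ)).mul
    (Δ.continuous_sum_integral_comp_sub_of_le_sq continuous_energy norm_energy_le z.memLp_rate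
      fun j => (hvel j).prodMk (hu j))
  exact lowerSemicontinuousOn_ereal_add
    (lowerSemicontinuousOn_ereal_add hterminal (lowerSemicontinuousOn_ereal_sum _ fun j _ =>
      lowerSemicontinuousOn_coe_mul (Δ.h_pos j) (hrunning j)))
    ((continuous_coe_real_ereal.comp hpenalty).lowerSemicontinuous.lowerSemicontinuousOn _)

lemma DiscreteFeasible.exists_discreteOptimal {w : DiscreteQuad n m d Δ.ν}
    (hw : DiscreteFeasible z ε δ Δ w) (hcompact : IsCompact (discreteFeasibleSet z ε δ Δ))
    (hJ : LowerSemicontinuousOn (fun p => discreteJ z Δ (DiscreteQuad.ofProd p))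
      (discreteFeasibleSet z ε δ Δ)) :
    ∃ w, DiscreteOptimal z ε δ Δ w := by
  obtain ⟨p, hp, hmin⟩ := hJ.exists_isMinOn ⟨(w.pos, w.u), hw⟩ hcompact
  exact ⟨DiscreteQuad.ofProd p, hp, fun w' hw' => isMinOn_iff.1 hmin (w'.pos, w'.u) hw'⟩

end SweepingControl

theorem proposition5p1_general {n m d : ℕ} (P : Data n m d) (z : Quad P) (hz : z.Feasible)
    (hU : IsClosed P.U) {L : NNReal}
    (hg : LipschitzOnWith L (Function.uncurry P.g) (univ ×ˢ P.U))
    (hslater : ∀ t ∈ Icc 0 P.T, Slater (z.a.toFun t) (z.b.toFun t))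
    {ρ : ℝ} (hρ : 0 < ρ) (hφ : LowerSemicontinuous P.φ) (hBV : BVQuad z) (hu0 : z.u 0 ∈ P.U) :
    ∃ ε₀ > 0, ∀ ε, 0 < ε → ε ≤ ε₀ → ∃ η > 0, ∀ Δ : Mesh P.T, (∀ j, Δ.h j ≤ η) →
      (∀ j : Fin Δ.ν, LowerSemicontinuousOn (P.ℓ (Δ.t j.castSucc)) (tube z ρ (Δ.t j.castSucc))) →
        ∀ δ, 0 ≤ δ → ∃ w, DiscreteOptimal z ε δ Δ w := by
  obtain ⟨r, hr, hslater_near⟩ := z.exists_slater_radius hslater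
  refine ⟨min (r ^ 2 / P.T) (ρ ^ 2 / P.T),
    lt_min (div_pos (pow_pos hr 2) P.T_pos) (div_pos (pow_pos hρ 2) P.T_pos), fun ε hε hε₀ => ?_⟩
  obtain ⟨η, hη, hfeasible⟩ := z.exists_discreteFeasible hz hU hg hBV hslater hu0 hε
  refine ⟨η, hη, fun Δ hΔ hℓ δ hδ => ?_⟩
  obtain ⟨w, hw⟩ := hfeasible Δ hΔ δ hδ
  exact hw.exists_discreteOptimal
    (isCompact_discreteFeasibleSet hz.initial hr (hε₀.trans (min_le_left _ _)) hU hg.continuousOn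
      hslater_near)
    (lowerSemicontinuousOn_discreteJ hz.initial hρ (hε₀.trans (min_le_right _ _)) hφ hℓ)

theorem proposition5p1 {n m d : ℕ} (P : Data n m d) (z : Quad P)
    (εbar : ℝ) (hz : z.IsRILM εbar)
    (h1 : CompactControls P) (h2 : BoundedDerivatives z) (h3 : PerturbationRegular P) (h4 : UniformSlater z)
    (ρ c : ℝ) (hρ : 0 < ρ) (h5 : CostRegular z ρ c)
    (hBV : BVQuad z) (hu0 : z.u 0 ∈ P.U) :
    ∃ ε₀ : ℝ, 0 < ε₀ ∧ ε₀ ≤ εbar ∧ ∀ ε : ℝ, 0 < ε → ε ≤ ε₀ →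
      ∀ (νtilde : ℝ) (Δ : ℕ → Mesh P.T) (δ : ℕ → ℝ),
        0 < νtilde →
        (∀ k, k ≤ (Δ k).ν) →
        (∀ k, ∀ j : Fin (Δ k).ν, (Δ k).h j ≤ νtilde / ((Δ k).ν : ℝ)) →
        (∀ k, ∀ j : Fin (Δ k).ν, RunningCostRegularAt z ρ c ((Δ k).t j.castSucc)) →
        (∀ k, 0 < δ k) →
        Tendsto δ atTop (𝓝 0) →
        ∀ᶠ k in atTop, ∃ w : DiscreteQuad n m d (Δ k).ν, DiscreteOptimal z ε (δ k) (Δ k) w := by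
  obtain ⟨L, hg⟩ := h3.exists_lipschitzOnWith
  obtain ⟨ε₀, hε₀, hexists⟩ := proposition5p1_general P z hz.feasible h1.1 hg
    (fun t ht => h4.slater ht) hρ h5.1 hBV hu0
  refine ⟨min εbar ε₀, lt_min hz.pos hε₀, min_le_left _ _,
    fun ε hε hεle νtilde Δ δ hνtilde hν hh hℓ hδ _ => ?_⟩
  obtain ⟨η, hη, hopt⟩ := hexists ε hε (hεle.trans (min_le_right _ _))
  filter_upwards [Mesh.eventually_h_le hη hν hνtilde.le hh] with k hk
  exact hopt (Δ k) hk (fun j => (hℓ k j).1) (δ k) (hδ k).le
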